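/- Let $\Lambda$ be Lebesgue measure and let $\nu$ be a nonzero finite Borel measure on $(0,1)$, regarded as a Borel measure on $\mathbb{R}$ with topological support $\operatorname{supp}\nu\subseteq[0,1]$. Let $H^1_0(0,1)$ be the space of functions $f:[0,1]\to\mathbb{R}$ with $f(0)=f(1)=0$ for which there is $\nabla f\in L^2_\Lambda(0,1)$ with $f(x)=f(0)+\int_0^x\nabla f\,d\Lambda$ for all $x\in[0,1]$. Let $\operatorname{dom}(\mathcal{E}_\nu)$ be the set of $f\in H^1_0(0,1)$ that are affine on every connected component of $[0,1]\setminus\operatorname{supp}\nu$, and put $\mathcal{E}_\nu(f,g)=\int_{(0,1)}\nabla f\,\nabla g\,d\Lambda$. A function $f\in\operatorname{dom}(\mathcal{E}_\nu)\setminus\{0\}$ is an eigenfunction with eigenvalue $\lambda\in\mathbb{R}$ if $\mathcal{E}_\nu(f,g)=\lambda\int fg\,d\nu$ for all $g\in\operatorname{dom}(\mathcal{E}_\nu)$. Let $N_\nu(x)$ be the number of eigenvalues not exceeding $x$, counted with multiplicity (the dimension of the span of all eigenfunctions with eigenvalue at most $x$), and define the lower and upper spectral dimensions $$\underline{s}_\nu=\liminf_{x\to\infty}\frac{\log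 N_\nu(x)}{\log x},\qquad \overline{s}_\nu=\limsup_{x\to\infty}\frac{\log N_\nu(x)}{\log x}.$$ For $q\in\mathbb{R}$ let $\beta_\nu(q)=\limsup_{n\to\infty}\frac{1}{\log 2^n}\log\sum_{C}\nu(C)^q$, where $C$ runs over the dyadic intervals $(k2^{-n},(k+1)2^{-n}]$, $0\le k<2^n$, with $\nu(C)>0$. Let $\overline{\delta}_\nu=\lim_{t\nearrow1}\beta_\nu(t)/(1-t)$ and $\underline{\delta}_\nu=\lim_{t\searrow1}\beta_\nu(t)/(1-t)$ be the negated left and right derivatives of $\beta_\nu$ at $1$ (note that $\beta_\nu(1)=0$). Let $\delta^*_\nu=\limsup_{\varepsilon\downarrow0}\frac{\log N_\varepsilon}{-\log\varepsilon}$ be the upper Minkowski dimension of $\operatorname{supp}\nu$, where $N_\varepsilon$ is the least number of closed $\varepsilon$-balls centred in $\operatorname{supp}\nu$ that cover $\operatorname{supp}\nu$. Then the limits defining $\overline{\delta}_\nu$ and $\underline{\delta}_\nu$ exist, all five quantities are finite real numbers, and $$\frac{\underline{\delta}_\nu}{1+\overline{\delta}_\nu}\le\underline{s}_\nu\le\overline{s}_\nu\le\frac{\delta^*_\nu}{1+\delta^*_\nu}\le\frac12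 .$$ Moreover, $\overline{s}_\nu=\frac{\delta^*_\nu}{1+\delta^*_\nu}$ if and only if $\overline{\delta}_\nu=\delta^*_\nu$. -/

import Mathlib

open MeasureTheory Filter Set Topology
open scoped ENNReal NNReal

namespace KreinFeller

noncomputable section

/-- `g` is a weak gradient of `f` on `(0,1)`: `g` is square integrable with respect to Lebesgue
measure and `f x = f 0 + ∫₀ˣ g` for every `x ∈ [0,1]`. -/
def IsWeakGradient (f g : ℝ → ℝ) : Prop :=
  MemLp g 2 (volume.restrict (Ioo (0 : ℝ) 1)) ∧
    ∀ x ∈ Icc (0 : ℝ) 1, f x = f 0 + ∫ t in (0 : ℝ)..x, g t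

/-- The Sobolev space `H¹₀(0,1)`. A function on `[0,1]` that vanishes at both endpoints is
identified with its extension by zero to the real line. -/
def H10 : Set (ℝ → ℝ) :=
  {f | (∃ g, IsWeakGradient f g) ∧ ∀ x, x ∉ Ioo (0 : ℝ) 1 → f x = 0}

open Classical in
/-- The weak gradient `∇f` of `f` (unique up to Lebesgue null sets when it exists). -/
def weakGradient (f : ℝ → ℝ) : ℝ → ℝ :=
  if h : ∃ g, IsWeakGradient f g then h.choose else 0

/-- `f` is affine on every connected component of `[0,1] \ supp ν`. -/
def IsAffineOffSupport (ν : Measure ℝ) (f : ℝ → ℝ) : Prop :=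
  ∀ x ∈ Icc (0 : ℝ) 1 \ ν.support, ∃ m c : ℝ,
    ∀ y ∈ connectedComponentIn (Icc (0 : ℝ) 1 \ ν.support) x, f y = m * y + c

/-- The (Dirichlet) domain of the form: functions in `H¹₀(0,1)` that are affine on the components
of `[0,1] \ supp ν`. -/
def formDomain (ν : Measure ℝ) : Set (ℝ → ℝ) :=
  {f | f ∈ H10 ∧ IsAffineOffSupport ν f}

/-- The form `ℰ(f,g) = ∫ ∇f ∇g dΛ` over `(0,1)`. -/
def energy (f g : ℝ → ℝ) : ℝ :=
  ∫ x in Ioo (0 : ℝ) 1, weakGradient f x * weakGradient g x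

/-- `f` is an eigenfunction of the form `ℰ_ν` with eigenvalue `l`. -/
def IsEigenfunction (ν : Measure ℝ) (l : ℝ) (f : ℝ → ℝ) : Prop :=
  f ∈ formDomain ν ∧ f ≠ 0 ∧
    ∀ g ∈ formDomain ν, energy f g = l * ∫ x, f x * g x ∂ν

/-- The eigenvalue counting function: the number of eigenvalues not exceeding `x`, counted with
multiplicity, that is, the dimension of the space spanned by all eigenfunctions with eigenvalue at
most `x` (eigenfunctions for different eigenvalues are linearly independent). -/
def eigenvalueCount (ν : Measure ℝ) (x : ℝ) : ℕ∞ :=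
  Cardinal.toENat
    (Module.rank ℝ (Submodule.span ℝ {f : ℝ → ℝ | ∃ l ≤ x, IsEigenfunction ν l f}))

/-- The quotient `log N_ν(x) / log x`, as an extended real number. -/
def spectralQuotient (ν : Measure ℝ) (x : ℝ) : EReal :=
  ENNReal.log (eigenvalueCount ν x : ℝ≥0∞) / ((Real.log x : ℝ) : EReal)

/-- The lower spectral dimension. -/
def lowerSpectralDim (ν : Measure ℝ) : EReal :=
  liminf (spectralQuotient ν) atTop

/-- The upper spectral dimension. -/
def upperSpectralDim (ν : Measure ℝ) : EReal :=
  limsup (spectralQuotient ν) atTop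

/-- The dyadic interval `(k 2⁻ⁿ, (k+1) 2⁻ⁿ]`. -/
def dyadicCell (n k : ℕ) : Set ℝ :=
  Ioc ((k : ℝ) / 2 ^ n) (((k : ℝ) + 1) / 2 ^ n)

open Classical in
/-- `β_n(q) = (log 2ⁿ)⁻¹ log ∑ ν(C)^q`, the sum over the dyadic intervals `C ⊆ (0,1]` of
length `2⁻ⁿ` with `ν(C) > 0`. -/
def lqSpectrumAt (ν : Measure ℝ) (n : ℕ) (q : ℝ) : ℝ :=
  1 / Real.log ((2 : ℝ) ^ n) *
    Real.log (∑ k ∈ (Finset.range (2 ^ n)).filter (fun k => 0 < ν (dyadicCell n k)),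
      (ν (dyadicCell n k)).toReal ^ q)

/-- The `L^q`-spectrum `β_ν(q) = limsup β_n(q)`, as an extended real number. -/
def lqSpectrum (ν : Measure ℝ) (q : ℝ) : EReal :=
  limsup (fun n : ℕ => ((lqSpectrumAt ν n q : ℝ) : EReal)) atTop

/-- The upper Minkowski (box-counting) dimension `limsup_{ε ↓ 0} log N_ε(A) / (- log ε)`, where
`N_ε(A)` is the least number of closed `ε`-balls with centres in `A` that cover `A`. -/
def upperMinkowskiDim (A : Set ℝ) : EReal :=
  limsup (fun ε : ℝ =>
    ENNReal.log (Metric.coveringNumber ε.toNNReal A : ℝ≥0∞) / ((-Real.log ε : ℝ) : EReal))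
    (𝓝[>] (0 : ℝ))

end

end KreinFeller
/-!
On gradients, the inverse of the Kreĭn–Feller operator is the compact positive operator
`∫ ⟪k_x, ·⟫ k_x dν(x)`, where `k_x` represents the evaluation at `x`, so that the eigenvalues can be
counted variationally. Trapezoids over disjoint enlarged cells of level `n` and measure at least `m`
have Rayleigh quotient of order `2ⁿ / m` or less, which bounds `N_ν` from below. Conversely, bisect
each dyadic cell `C` with `ν(C) Λ(C) > t`, starting from `(0,1]`. A function which vanishes at all
bisection points has Rayleigh quotient at least `1 / t`, so the number of bisections bounds `N_ν(x)`
from above if `x t < 1`.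

Comparing the numbers of such cells with partition sums shows for the upper spectral dimension `s`
that `β(q) < q` implies `s ≤ q`, and `s < q` implies `β(q) ≤ s`: it is the fixed point of `β`. As
`β` is convex with `β(0) = δ*` and `β(1) = 0`, it lies below the chord `δ* (1 - q)`, whose fixed
point is `δ* / (1 + δ*)`, and it touches the chord there only if it is affine on `[0,1]`, that is,
if its negated left derivative at `1` is `δ*`.

For the lower spectral dimension, note that for `b` below the negated right derivative of `β` at `1`
and `a` above the left one, most of the mass lies in cells with measure between `2^(-na)` and
`2^(-nb)`; there are at least about `2^(nb)` of them, each giving an eigenvalue of order at most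
`2^(n(1+a))`.
-/

namespace KreinFeller

/-! ### Eigenvalue counts and quadratic forms -/

section OrthogonalFamilies

variable {H ι : Type*} [NormedAddCommGroup H] [InnerProductSpace ℝ H]

theorem inner_map_sum_of_pairwise {T : H →ₗ[ℝ] H} {s : Finset ι} {v : ι → H}
    (h : (s : Set ι).Pairwise fun i j => inner ℝ (T (v i)) (v j) = 0) :
    inner ℝ (T (∑ i ∈ s, v i)) (∑ i ∈ s, v i) = ∑ i ∈ s, inner ℝ (T (v i)) (v i) := by
  rw [map_sum, sum_inner]
  refine Finset.sum_congr rfl fun i hi => ?_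
  rw [inner_sum, Finset.sum_eq_single_of_mem i hi fun j hj hji => h hi hj hji.symm]

theorem norm_sum_sq_of_pairwise {s : Finset ι} {v : ι → H}
    (h : (s : Set ι).Pairwise fun i j => inner ℝ (v i) (v j) = 0) :
    ‖∑ i ∈ s, v i‖ ^ 2 = ∑ i ∈ s, ‖v i‖ ^ 2 := by
  simpa only [LinearMap.id_apply, real_inner_self_eq_norm_sq] using
    inner_map_sum_of_pairwise (T := LinearMap.id) h

end OrthogonalFamilies

section CompactSymmetric

variable {H : Type*} [NormedAddCommGroup H] [InnerProductSpace ℝ H] {T : H →L[ℝ] H} {c : ℝ}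

theorem inner_apply_self_le_of_mem_iSup_eigenspace (hs : (T : H →ₗ[ℝ] H).IsSymmetric)
    (hc : ∀ μ : ℝ, Module.End.HasEigenvalue (T : Module.End ℝ H) μ → μ ≤ c) {v : H}
    (hv : v ∈ ⨆ μ, Module.End.eigenspace (T : Module.End ℝ H) μ) :
    inner ℝ (T v) v ≤ c * ‖v‖ ^ 2 := by
  obtain ⟨f, hf, rfl⟩ := (Submodule.mem_iSup_iff_exists_finsupp _ _).1 hv
  have hTf : ∀ μ, T (f μ) = μ • f μ := fun μ => Module.End.mem_eigenspace_iff.1 (hf μ)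
  have horth : (f.support : Set ℝ).Pairwise fun μ κ => inner ℝ (f μ) (f κ) = 0 :=
    fun μ _ κ _ hne => hs.orthogonalFamily_eigenspaces hne ⟨f μ, hf μ⟩ ⟨f κ, hf κ⟩
  have hTorth : (f.support : Set ℝ).Pairwise
      fun μ κ => inner ℝ ((T : H →ₗ[ℝ] H) (f μ)) (f κ) = 0 := fun μ hμ κ hκ hne => by
    simp [hTf, inner_smul_left, horth hμ hκ hne]
  rw [Finsupp.sum, norm_sum_sq_of_pairwise horth, Finset.mul_sum]
  refine (inner_map_sum_of_pairwise hTorth).trans_le (Finset.sum_le_sum fun μ hμ => ?_)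
  rw [ContinuousLinearMap.coe_coe, hTf, inner_smul_left, real_inner_self_eq_norm_sq]
  exact mul_le_mul_of_nonneg_right
    (hc μ (Module.End.hasEigenvalue_of_hasEigenvector ⟨hf μ, Finsupp.mem_support_iff.1 hμ⟩))
    (sq_nonneg _)

/-- The span of the eigenvectors of `T` for eigenvalues at least `c`. -/
def upperEigenspan (T : H →L[ℝ] H) (c : ℝ) : Submodule ℝ H :=
  Submodule.span ℝ {v | ∃ μ, c ≤ μ ∧ T v = μ • v}

theorem apply_mem_upperEigenspan {v : H} (hv : v ∈ upperEigenspan T c) :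
    T v ∈ upperEigenspan T c := by
  suffices upperEigenspan T c ≤ (upperEigenspan T c).comap (T : H →ₗ[ℝ] H) from this hv
  refine Submodule.span_le.2 ?_
  rintro w ⟨μ, hμ, hw⟩
  have hmem : μ • w ∈ upperEigenspan T c :=
    Submodule.smul_mem _ _ (Submodule.subset_span ⟨μ, hμ, hw⟩)
  rwa [← hw] at hmem

variable [CompleteSpace H]

theorem inner_apply_self_le_of_eigenvalues_le (hT : IsCompactOperator T)
    (hs : (T : H →ₗ[ℝ] H).IsSymmetric)
    (hc : ∀ μ : ℝ, Module.End.HasEigenvalue (T : Module.End ℝ H) μ → μ ≤ c) (v : H) :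
    inner ℝ (T v) v ≤ c * ‖v‖ ^ 2 := by
  have hdense : Dense ((⨆ μ, Module.End.eigenspace (T : Module.End ℝ H) μ : Submodule ℝ H) :
      Set H) := by
    rw [Submodule.dense_iff_topologicalClosure_eq_top, Submodule.topologicalClosure_eq_top_iff]
    exact ContinuousLinearMap.orthogonalComplement_iSup_eigenspaces_eq_bot hT hs
  have hclosed : IsClosed {w : H | inner ℝ (T w) w ≤ c * ‖w‖ ^ 2} :=
    isClosed_le (T.continuous.inner continuous_id) (by fun_prop)
  exact hclosed.closure_subset_iff.2
    (fun w hw => inner_apply_self_le_of_mem_iSup_eigenspace hs hc hw) (hdense v)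

theorem inner_apply_self_le_of_mem_orthogonal (hT : IsCompactOperator T)
    (hs : (T : H →ₗ[ℝ] H).IsSymmetric) {v : H} (hv : v ∈ (upperEigenspan T c)ᗮ) :
    inner ℝ (T v) v ≤ c * ‖v‖ ^ 2 := by
  have hinv : ∀ w ∈ (upperEigenspan T c)ᗮ, (T : H →ₗ[ℝ] H) w ∈ (upperEigenspan T c)ᗮ :=
    fun w hw u hu => by rw [← hs u w]; exact hw _ (apply_mem_upperEigenspan hu)
  let S : (upperEigenspan T c)ᗮ →L[ℝ] (upperEigenspan T c)ᗮ := T.restrict hinv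
  have hS : ∀ μ : ℝ, Module.End.HasEigenvalue (S : Module.End ℝ (upperEigenspan T c)ᗮ) μ →
      μ ≤ c := by
    intro μ hμ
    by_contra! hcμ
    obtain ⟨w, hw⟩ := hμ.exists_hasEigenvector
    have hTw : T (w : H) = μ • (w : H) := congrArg Subtype.val hw.apply_eq_smul
    have hmem : (w : H) ∈ upperEigenspan T c := Submodule.subset_span ⟨μ, hcμ.le, hTw⟩
    exact hw.2 (Subtype.ext (inner_self_eq_zero.1 (w.2 _ hmem)))
  exact inner_apply_self_le_of_eigenvalues_le (T := S) (hT.restrict' hinv)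
    (hs.restrict_invariant hinv) hS ⟨v, hv⟩

theorem card_le_rank_upperEigenspan (hT : IsCompactOperator T)
    (hs : (T : H →ₗ[ℝ] H).IsSymmetric) {ι : Type*} [Fintype ι] {v : ι → H}
    (horth : Pairwise fun i j => inner ℝ (v i) (v j) = 0)
    (hTorth : Pairwise fun i j => inner ℝ (T (v i)) (v j) = 0)
    (hlt : ∀ i, c * ‖v i‖ ^ 2 < inner ℝ (T (v i)) (v i)) :
    (Fintype.card ι : Cardinal) ≤ Module.rank ℝ (upperEigenspan T c) := by
  by_contra! hcard
  set W := upperEigenspan T c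
  have : FiniteDimensional ℝ W :=
    Module.rank_lt_aleph0_iff.1 (hcard.trans Cardinal.natCast_lt_aleph0)
  rw [← Module.finrank_eq_rank, Nat.cast_lt] at hcard
  let L : (ι → ℝ) →ₗ[ℝ] W :=
    (W.orthogonalProjectionOnto : H →L[ℝ] W).toLinearMap ∘ₗ Fintype.linearCombination ℝ v
  obtain ⟨a, ha, ha0⟩ := Submodule.exists_mem_ne_zero_of_ne_bot
    (LinearMap.ker_ne_bot_of_finrank_lt (f := L) (by simpa using hcard))
  have hmem : (∑ i, a i • v i) ∈ Wᗮ := Submodule.orthogonalProjectionOnto_eq_zero_iff.1 ha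
  have hnorm : ‖∑ i, a i • v i‖ ^ 2 = ∑ i, a i ^ 2 * ‖v i‖ ^ 2 := by
    rw [norm_sum_sq_of_pairwise fun i _ j _ hij => by
      simp [inner_smul_left, inner_smul_right, horth hij]]
    simp [norm_smul, mul_pow]
  have hform : inner ℝ (T (∑ i, a i • v i)) (∑ i, a i • v i) =
      ∑ i, a i ^ 2 * inner ℝ (T (v i)) (v i) := by
    refine (inner_map_sum_of_pairwise (T := (T : H →ₗ[ℝ] H)) fun i _ j _ hij => ?_).trans ?_
    · simp [inner_smul_left, inner_smul_right, hTorth hij]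
    · simp [inner_smul_left, inner_smul_right, sq, mul_assoc]
  have hle := inner_apply_self_le_of_mem_orthogonal hT hs hmem
  rw [hform, hnorm, Finset.mul_sum] at hle
  refine absurd hle (not_le.2 ?_)
  obtain ⟨i, hi⟩ := Function.ne_iff.1 ha0
  refine Finset.sum_lt_sum (fun j _ => ?_) ⟨i, Finset.mem_univ _, ?_⟩
  · nlinarith [sq_nonneg (a j), hlt j]
  · nlinarith [sq_pos_of_ne_zero hi, hlt i]

end CompactSymmetric

section PositiveForm

variable {H ι : Type*} [NormedAddCommGroup H] [InnerProductSpace ℝ H] [Fintype ι]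

theorem norm_sum_sq_le_of_inner_eq {T : H →L[ℝ] H} (hT : T.IsPositive) {g : ι → H} {l : ι → ℝ}
    {x : ℝ} (hl : ∀ i, l i ≤ x)
    (hg : ∀ i j, inner ℝ (g i) (g j) = l i * inner ℝ (T (g i)) (g j)) :
    ‖∑ i, g i‖ ^ 2 ≤ x * inner ℝ (T (∑ i, g i)) (∑ i, g i) := by
  -- Either `l i = l j` or `⟪T (g i), g j⟫ = 0`, so the difference of the two sides is the value of
  -- the form of `T` at `∑ √(x - l i) • g i`.
  have hsqrt : ∀ i j, (x - l i) * inner ℝ (T (g i)) (g j) =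
      √(x - l i) * √(x - l j) * inner ℝ (T (g i)) (g j) := by
    intro i j
    have hsymm : l i * inner ℝ (T (g i)) (g j) = l j * inner ℝ (T (g i)) (g j) := by
      have hTij : inner ℝ (T (g i)) (g j) = inner ℝ (T (g j)) (g i) :=
        (hT.1 (g i) (g j)).trans (real_inner_comm _ _)
      rw [← hg, real_inner_comm, hg, hTij]
    rcases mul_eq_mul_right_iff.1 hsymm with h | h
    · rw [h, Real.mul_self_sqrt (by linarith [hl j])]
    · rw [h, mul_zero, mul_zero]
  have hnonneg := hT.2 (∑ i, √(x - l i) • g i)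
  rw [ContinuousLinearMap.reApplyInnerSelf_apply] at hnonneg
  rw [← real_inner_self_eq_norm_sq, ← sub_nonneg]
  refine hnonneg.trans_eq ?_
  simp only [map_sum, map_smul, sum_inner, inner_sum, inner_smul_left, inner_smul_right,
    Finset.mul_sum, conj_trivial, RCLike.re_to_real, ← Finset.sum_sub_distrib]
  refine Finset.sum_congr rfl fun i _ => Finset.sum_congr rfl fun j _ => ?_
  rw [hg]
  linear_combination -hsqrt j i

end PositiveForm

noncomputable section

section FrameOperator

theorem integral_mem_of_isClosed {X E : Type*} [MeasurableSpace X] {μ : Measure X}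
    [NormedAddCommGroup E] [NormedSpace ℝ E] [CompleteSpace E] {K : Submodule ℝ E}
    (hK : IsClosed (K : Set E)) {f : X → E} (hf : ∀ x, f x ∈ K) : ∫ x, f x ∂μ ∈ K := by
  by_cases hi : Integrable f μ
  · have : IsClosed (K : Set E) := hK
    rw [← Submodule.Quotient.mk_eq_zero]
    refine (K.mkQL.integral_comp_comm hi).symm.trans ?_
    exact integral_eq_zero_of_ae (ae_of_all _ fun x => (Submodule.Quotient.mk_eq_zero K).2 (hf x))
  · rw [integral_undef hi]
    exact K.zero_mem

theorem isCompactOperator_rankOne {H : Type*} [NormedAddCommGroup H] [InnerProductSpace ℝ H]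
    (u v : H) : IsCompactOperator (InnerProductSpace.rankOne ℝ u v : H →L[ℝ] H) := by
  have hcomp : (InnerProductSpace.rankOne ℝ u v : H →L[ℝ] H) =
      (ContinuousLinearMap.toSpanSingleton ℝ u).comp (innerSL ℝ v) := by
    ext w
    simp [InnerProductSpace.rankOne_apply]
  rw [hcomp]
  exact (isCompactOperator_of_locallyCompactSpace_rng
    (ContinuousLinearMap.toSpanSingleton ℝ u)).comp_clm (innerSL ℝ v)

variable {X H : Type*} [MeasurableSpace X] [NormedAddCommGroup H] [InnerProductSpace ℝ H]

/-- The operator `∫ ⟪k x, ·⟫ k x dν(x)` attached to a square integrable family of vectors `k`. -/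
def frameOperator (ν : Measure X) (k : X → H) : H →L[ℝ] H :=
  ∫ x, InnerProductSpace.rankOne ℝ (k x) (k x) ∂ν

variable {ν : Measure X} {k : X → H}

theorem integrable_rankOne (hk : MemLp k 2 ν) :
    Integrable (fun x => (InnerProductSpace.rankOne ℝ (k x) (k x) : H →L[ℝ] H)) ν := by
  refine (hk.integrable_norm_pow two_ne_zero).mono' ?_ (ae_of_all _ fun x => ?_)
  · have hcont : Continuous fun v : H => (InnerProductSpace.rankOne ℝ v v : H →L[ℝ] H) := by
      simp only [InnerProductSpace.rankOne_def]
      fun_prop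
    exact hcont.comp_aestronglyMeasurable hk.1
  · rw [InnerProductSpace.norm_rankOne, sq]

theorem integrable_inner_mul_inner (hk : MemLp k 2 ν) (f g : H) :
    Integrable (fun x => inner ℝ (k x) f * inner ℝ (k x) g) ν :=
  (hk.inner_const f).integrable_mul (hk.inner_const g)

variable [CompleteSpace H]

theorem isCompactOperator_frameOperator (ν : Measure X) (k : X → H) :
    IsCompactOperator (frameOperator ν k) :=
  integral_mem_of_isClosed (K := compactOperator (RingHom.id ℝ) H H)
    isClosed_setOfPred_isCompactOperator fun _ => isCompactOperator_rankOne _ _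

theorem inner_frameOperator (hk : MemLp k 2 ν) (f g : H) :
    inner ℝ (frameOperator ν k f) g = ∫ x, inner ℝ (k x) f * inner ℝ (k x) g ∂ν := by
  have hi := integrable_rankOne hk
  rw [frameOperator, ContinuousLinearMap.integral_apply hi, real_inner_comm,
    ← integral_inner (hi.apply_continuousLinearMap f)]
  exact integral_congr_ae (ae_of_all _ fun x => by
    simp [InnerProductSpace.rankOne_apply, inner_smul_right, real_inner_comm])

theorem isPositive_frameOperator (hk : MemLp k 2 ν) : (frameOperator ν k).IsPositive := by
  refine ⟨fun f g => ?_, fun f => ?_⟩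
  · rw [ContinuousLinearMap.coe_coe, real_inner_comm _ f, inner_frameOperator hk,
      inner_frameOperator hk]
    simp only [mul_comm]
  · rw [ContinuousLinearMap.reApplyInnerSelf_apply, RCLike.re_to_real, inner_frameOperator hk]
    exact integral_nonneg fun x => mul_self_nonneg _

end FrameOperator

/-! ### The gradient space of `H¹₀(0,1)` -/

section GradientSpace

/-- The Lebesgue measure on `(0,1)`. -/
abbrev unitVolume : Measure ℝ := volume.restrict (Ioo (0 : ℝ) 1)

/-- The indicator function of `(-∞, x]` in `L²(0,1)`. -/
def stepVec (x : ℝ) : Lp ℝ 2 unitVolume :=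
  indicatorConstLp 2 (measurableSet_Iic : MeasurableSet (Iic x)) (measure_ne_top _ _) 1

/-- The projection of the real line onto `[0,1]`; it is also the length of `(0,1) ∩ (-∞, x]`. -/
def clamp (x : ℝ) : ℝ := max 0 (min x 1)

theorem clamp_of_mem {x : ℝ} (hx : x ∈ Icc (0 : ℝ) 1) : clamp x = x := by
  rw [clamp, min_eq_left hx.2, max_eq_right hx.1]

theorem clamp_of_le {x : ℝ} (hx : x ≤ 0) : clamp x = 0 :=
  max_eq_left ((min_le_left _ _).trans hx)

theorem clamp_of_ge {x : ℝ} (hx : 1 ≤ x) : clamp x = 1 := by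
  rw [clamp, min_eq_right hx, max_eq_right zero_le_one]

theorem measureReal_unitVolume_Iic (x : ℝ) : unitVolume.real (Iic x) = clamp x := by
  rw [measureReal_restrict_apply measurableSet_Iic, clamp]
  rcases lt_or_ge x 1 with h | h
  · have : Iic x ∩ Ioo (0 : ℝ) 1 = Ioc 0 x := by ext y; simp; grind
    rw [this, Real.volume_real_Ioc, min_eq_left h.le, sub_zero, max_comm]
  · have : Iic x ∩ Ioo (0 : ℝ) 1 = Ioo 0 1 := by ext y; simp; grind
    rw [this, Real.volume_real_Ioo, min_eq_right h, sub_zero, max_comm]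

theorem inner_stepVec_stepVec (x y : ℝ) :
    inner ℝ (stepVec x) (stepVec y) = clamp (min x y) := by
  rw [stepVec, stepVec, L2.real_inner_indicatorConstLp_one_indicatorConstLp_one, Iic_inter_Iic,
    measureReal_unitVolume_Iic]

theorem norm_stepVec_le (x : ℝ) : ‖stepVec x‖ ≤ 1 := by
  rw [← sq_le_one_iff₀ (norm_nonneg _), ← real_inner_self_eq_norm_sq, inner_stepVec_stepVec, clamp]
  simp

theorem stepVec_of_le {x : ℝ} (hx : x ≤ 0) : stepVec x = 0 := by
  rw [← inner_self_eq_zero (𝕜 := ℝ), inner_stepVec_stepVec, min_self, clamp_of_le hx]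

theorem stepVec_of_ge {x : ℝ} (hx : 1 ≤ x) : stepVec x = stepVec 1 := by
  rw [← sub_eq_zero, ← inner_self_eq_zero (𝕜 := ℝ)]
  simp only [inner_sub_left, inner_sub_right, inner_stepVec_stepVec]
  simp [hx, clamp_of_ge]

theorem continuous_stepVec : Continuous stepVec := by
  refine continuous_indicatorConstLp_set (by norm_num) fun x => ?_
  have hle : ∀ y, unitVolume (symmDiff (Iic y) (Iic x)) ≤ ENNReal.ofReal |y - x| := fun y =>
    calc unitVolume (symmDiff (Iic y) (Iic x)) ≤ volume (symmDiff (Iic y) (Iic x)) :=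
          Measure.restrict_apply_le _ _
      _ ≤ volume (uIoc x y) := by
          refine measure_mono fun z hz => ?_
          simp only [mem_symmDiff, mem_Iic, mem_uIoc] at hz ⊢
          grind
      _ = ENNReal.ofReal |y - x| := Real.volume_uIoc
  refine tendsto_of_tendsto_of_tendsto_of_le_of_le tendsto_const_nhds ?_ (fun _ => zero_le) hle
  have hcont : Continuous fun y : ℝ => ENNReal.ofReal |y - x| :=
    ENNReal.continuous_ofReal.comp (by fun_prop)
  simpa using hcont.tendsto x

theorem inner_stepVec_eq_integral (g : Lp ℝ 2 unitVolume) {x : ℝ} (hx : x ∈ Icc (0 : ℝ) 1) :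
    inner ℝ (stepVec x) g = ∫ t in (0 : ℝ)..x, g t := by
  rw [stepVec, L2.inner_indicatorConstLp_one, Measure.restrict_restrict measurableSet_Iic,
    intervalIntegral.integral_of_le hx.1]
  have hIoc : Iic x ∩ Ioc 0 1 = Ioc 0 x := by
    rw [inter_comm, Ioc_inter_Iic, min_eq_right hx.2]
  exact setIntegral_congr_set (hIoc ▸ (ae_eq_refl (Iic x)).inter Ioo_ae_eq_Ioc)

/-- The gradients of the functions in `H¹₀(0,1)`: the functions in `L²(0,1)` with mean value
zero. -/
abbrev meanZero : Submodule ℝ (Lp ℝ 2 unitVolume) := (ℝ ∙ stepVec 1)ᗮ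

theorem inner_stepVec_one (g : meanZero) : inner ℝ (stepVec 1) (g : Lp ℝ 2 unitVolume) = 0 :=
  Submodule.mem_orthogonal_singleton_iff_inner_right.1 g.2

/-- The representing vector of the evaluation at `x` on `H¹₀(0,1)`. -/
def evalVec (x : ℝ) : meanZero := meanZero.orthogonalProjectionOnto (stepVec x)

theorem inner_evalVec (x : ℝ) (g : meanZero) :
    inner ℝ (evalVec x) g = inner ℝ (stepVec x) (g : Lp ℝ 2 unitVolume) :=
  Submodule.inner_orthogonalProjectionOnto_eq_of_mem_right g _

theorem continuous_evalVec : Continuous evalVec :=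
  meanZero.orthogonalProjectionOnto.continuous.comp continuous_stepVec

theorem norm_evalVec_le (x : ℝ) : ‖evalVec x‖ ≤ 1 :=
  (meanZero.orthogonalProjectionOnto.le_of_opNorm_le
    meanZero.orthogonalProjectionOnto_norm_le _).trans (by simpa using norm_stepVec_le x)

theorem memLp_evalVec (ν : Measure ℝ) [IsFiniteMeasure ν] : MemLp evalVec 2 ν :=
  MemLp.of_bound continuous_evalVec.aestronglyMeasurable 1 (ae_of_all _ norm_evalVec_le)

end GradientSpace

section Primitive

/-- The function in `H¹₀(0,1)` with gradient `g`. -/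
def primitive : meanZero →ₗ[ℝ] (ℝ → ℝ) where
  toFun g x := inner ℝ (evalVec x) g
  map_add' f g := by funext x; exact inner_add_right _ _ _
  map_smul' c g := by funext x; exact inner_smul_right _ _ _

theorem primitive_apply (g : meanZero) (x : ℝ) :
    primitive g x = inner ℝ (stepVec x) (g : Lp ℝ 2 unitVolume) :=
  inner_evalVec x g

theorem primitive_eq_integral (g : meanZero) {x : ℝ} (hx : x ∈ Icc (0 : ℝ) 1) :
    primitive g x = ∫ t in (0 : ℝ)..x, (g : Lp ℝ 2 unitVolume) t := by
  rw [primitive_apply, inner_stepVec_eq_integral _ hx]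

theorem primitive_eq_zero (g : meanZero) {x : ℝ} (hx : x ∉ Ioo (0 : ℝ) 1) :
    primitive g x = 0 := by
  rw [primitive_apply]
  rcases le_or_gt x 0 with h | h
  · rw [stepVec_of_le h, inner_zero_left]
  · rw [stepVec_of_ge (not_lt.1 fun h1 => hx ⟨h, h1⟩), inner_stepVec_one]

theorem integrable_primitive_mul (ν : Measure ℝ) [IsFiniteMeasure ν] (g h : meanZero) :
    Integrable (fun x => primitive g x * primitive h x) ν :=
  integrable_inner_mul_inner (memLp_evalVec ν) g h

theorem integrable_primitive_sq (ν : Measure ℝ) [IsFiniteMeasure ν] (g : meanZero) :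
    Integrable (fun x => primitive g x ^ 2) ν := by
  simpa only [sq] using integrable_primitive_mul ν g g

theorem intervalIntegrable_of_memLp {g : ℝ → ℝ} (hg : MemLp g 2 unitVolume) {a b : ℝ}
    (ha : a ∈ Icc (0 : ℝ) 1) (hb : b ∈ Icc (0 : ℝ) 1) : IntervalIntegrable g volume a b := by
  have hIcc : IntegrableOn g (Icc 0 1) := by
    rw [integrableOn_Icc_iff_integrableOn_Ioo]
    exact hg.integrable (by norm_num)
  exact (hIcc.mono_set (uIcc_subset_Icc ha hb)).intervalIntegrable

theorem primitive_sub_primitive (g : meanZero) {a b : ℝ} (ha : a ∈ Icc (0 : ℝ) 1)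
    (hb : b ∈ Icc (0 : ℝ) 1) :
    primitive g b - primitive g a = ∫ t in a..b, (g : Lp ℝ 2 unitVolume) t := by
  rw [primitive_eq_integral g ha, primitive_eq_integral g hb]
  exact intervalIntegral.integral_interval_sub_left
    (intervalIntegrable_of_memLp (Lp.memLp _) (by simp) hb)
    (intervalIntegrable_of_memLp (Lp.memLp _) (by simp) ha)

theorem ae_eq_zero_of_forall_integral_eq_zero {g : ℝ → ℝ} (hg : MemLp g 2 unitVolume)
    (h : ∀ x ∈ Icc (0 : ℝ) 1, ∫ t in (0 : ℝ)..x, g t = 0) : g =ᵐ[unitVolume] 0 := by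
  have hi := intervalIntegrable_of_memLp hg (a := 0) (b := 1) (by simp) (by simp)
  rw [EventuallyEq, ae_restrict_iff' measurableSet_Ioo]
  filter_upwards [hi.ae_hasDerivAt_integral] with x hx hx1
  rw [uIcc_of_le zero_le_one] at hx
  have hzero : HasDerivAt (fun x => ∫ t in (0 : ℝ)..x, g t) 0 x :=
    (hasDerivAt_const x (0 : ℝ)).congr_of_eventuallyEq <|
      mem_of_superset (Ioo_mem_nhds hx1.1 hx1.2) fun y hy => h y (Ioo_subset_Icc_self hy)
  exact (hx (Ioo_subset_Icc_self hx1) 0 (by simp)).unique hzero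

theorem IsWeakGradient.ae_eq {f g h : ℝ → ℝ} (hg : IsWeakGradient f g) (hh : IsWeakGradient f h) :
    g =ᵐ[unitVolume] h := by
  rw [← sub_ae_eq_zero]
  refine ae_eq_zero_of_forall_integral_eq_zero (hg.1.sub hh.1) fun x hx => ?_
  have hsub := intervalIntegral.integral_sub
    (intervalIntegrable_of_memLp hg.1 (a := 0) (by simp) hx)
    (intervalIntegrable_of_memLp hh.1 (a := 0) (by simp) hx)
  simp only [Pi.sub_apply]
  linarith [hg.2 x hx, hh.2 x hx]

theorem isWeakGradient_primitive (g : meanZero) :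
    IsWeakGradient (primitive g) (g : Lp ℝ 2 unitVolume) :=
  ⟨Lp.memLp _, fun x hx => by
    rw [primitive_eq_zero g (x := 0) (by simp), zero_add, primitive_eq_integral g hx]⟩

theorem weakGradient_primitive (g : meanZero) :
    weakGradient (primitive g) =ᵐ[unitVolume] (g : Lp ℝ 2 unitVolume) := by
  have hex : ∃ h, IsWeakGradient (primitive g) h := ⟨_, isWeakGradient_primitive g⟩
  rw [weakGradient, dif_pos hex]
  exact hex.choose_spec.ae_eq (isWeakGradient_primitive g)

theorem energy_primitive (g h : meanZero) : energy (primitive g) (primitive h) = inner ℝ g h := by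
  rw [energy, Submodule.coe_inner, L2.inner_def]
  refine integral_congr_ae ?_
  filter_upwards [weakGradient_primitive g, weakGradient_primitive h] with x hg hh
  rw [hg, hh]
  exact mul_comm _ _

theorem primitive_injective : Function.Injective primitive := by
  refine (injective_iff_map_eq_zero primitive).2 fun g hg => Subtype.ext ?_
  refine (Lp.eq_zero_iff_ae_eq_zero).2
    (ae_eq_zero_of_forall_integral_eq_zero (Lp.memLp _) fun x hx => ?_)
  rw [← primitive_eq_integral g hx, hg, Pi.zero_apply]

theorem primitive_mem_H10 (g : meanZero) : primitive g ∈ H10 :=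
  ⟨⟨_, isWeakGradient_primitive g⟩, fun _ hx => primitive_eq_zero g hx⟩

theorem exists_primitive_eq {f : ℝ → ℝ} (hf : f ∈ H10) : ∃ g : meanZero, primitive g = f := by
  obtain ⟨⟨G, hGm, hGi⟩, h0⟩ := hf
  have hint : ∀ x ∈ Icc (0 : ℝ) 1, inner ℝ (stepVec x) (hGm.toLp G) = f x := by
    intro x hx
    rw [inner_stepVec_eq_integral _ hx, hGi x hx, h0 0 (by simp), zero_add,
      intervalIntegral.integral_of_le hx.1, intervalIntegral.integral_of_le hx.1]
    refine integral_congr_ae (ae_restrict_of_ae_restrict_of_subset (Ioc_subset_Ioc_right hx.2) ?_)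
    rw [← Measure.restrict_congr_set Ioo_ae_eq_Ioc]
    exact hGm.coeFn_toLp
  have hmem : hGm.toLp G ∈ meanZero := Submodule.mem_orthogonal_singleton_iff_inner_right.2 <| by
    rw [hint 1 (by simp), h0 1 (by simp)]
  refine ⟨⟨_, hmem⟩, funext fun x => ?_⟩
  by_cases hx : x ∈ Ioo (0 : ℝ) 1
  · rw [primitive_apply, hint x (Ioo_subset_Icc_self hx)]
  · rw [primitive_eq_zero _ hx, h0 x hx]

end Primitive

/-! ### The Green operator and trapezoidal test functions -/

section GreenOperator

theorem inner_evalVec_evalVec {x y : ℝ} (hx : x ∈ Icc (0 : ℝ) 1) (hy : y ∈ Icc (0 : ℝ) 1) :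
    inner ℝ (evalVec x) (evalVec y) = min x y - x * y := by
  have hone : ‖stepVec 1‖ = 1 := by
    rw [← sq_eq_sq₀ (norm_nonneg _) zero_le_one, ← real_inner_self_eq_norm_sq,
      inner_stepVec_stepVec, min_self, clamp_of_ge le_rfl, one_pow]
  have hxy : min x y ∈ Icc (0 : ℝ) 1 := ⟨le_min hx.1 hy.1, (min_le_left x y).trans hx.2⟩
  rw [inner_evalVec, evalVec, Submodule.orthogonalProjectionOnto_orthogonal]
  simp only [Submodule.starProjection_unit_singleton ℝ hone, inner_sub_right,
    inner_smul_right, inner_stepVec_stepVec, clamp_of_mem hxy, min_eq_left hx.2,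
    min_eq_right hy.2, clamp_of_mem hx, clamp_of_mem hy]
  ring

/-- The inverse of the Kreĭn–Feller operator, acting on gradients: the operator on `meanZero` which
represents the inner product of `L²(ν)`. -/
def greenOperator (ν : Measure ℝ) : meanZero →L[ℝ] meanZero := frameOperator ν evalVec

theorem isCompactOperator_greenOperator (ν : Measure ℝ) : IsCompactOperator (greenOperator ν) :=
  isCompactOperator_frameOperator ν evalVec

theorem isPositive_greenOperator (ν : Measure ℝ) [IsFiniteMeasure ν] :
    (greenOperator ν).IsPositive :=
  isPositive_frameOperator (memLp_evalVec ν)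

theorem inner_greenOperator (ν : Measure ℝ) [IsFiniteMeasure ν] (g h : meanZero) :
    inner ℝ (greenOperator ν g) h = ∫ x, primitive g x * primitive h x ∂ν :=
  inner_frameOperator (memLp_evalVec ν) g h

end GreenOperator

/-- The breakpoints of the trapezoidal function which vanishes outside `(a, d)`, is `1` on `[b, c]`
and is affine on `[a, b]` and on `[c, d]`. -/
structure Trapezoid where
  (a b c d : ℝ)
  zero_le : 0 ≤ a
  a_lt_b : a < b
  b_le_c : b ≤ c
  c_lt_d : c < d
  le_one : d ≤ 1

namespace Trapezoid

variable (p q : Trapezoid)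

/-- The gradient of a trapezoidal function. -/
def grad : meanZero :=
  (p.b - p.a)⁻¹ • (evalVec p.b - evalVec p.a) - (p.d - p.c)⁻¹ • (evalVec p.d - evalVec p.c)

theorem inner_grad (v : meanZero) :
    inner ℝ p.grad v = slope (primitive v) p.a p.b - slope (primitive v) p.c p.d := by
  simp only [grad, inner_sub_left, inner_smul_left, slope_def_field, primitive, LinearMap.coe_mk,
    AddHom.coe_mk, conj_trivial]
  ring

theorem primitive_grad {y : ℝ} (hy : y ∈ Icc (0 : ℝ) 1) : primitive p.grad y =
    (min p.b y - min p.a y) / (p.b - p.a) - (min p.d y - min p.c y) / (p.d - p.c) := by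
  obtain ⟨a, b, c, d, ha, hab, hbc, hcd, hd⟩ := p
  have hgreen : ∀ x, 0 ≤ x → x ≤ 1 → primitive (evalVec y) x = min x y - x * y :=
    fun x h0 h1 => inner_evalVec_evalVec ⟨h0, h1⟩ hy
  have hba : b - a ≠ 0 := by linarith
  have hdc : d - c ≠ 0 := by linarith
  refine (real_inner_comm _ _).trans ((inner_grad _ (evalVec y)).trans ?_)
  simp only [slope_def_field]
  rw [hgreen a ha (by linarith), hgreen b (by linarith) (by linarith),
    hgreen c (by linarith) (by linarith), hgreen d (by linarith) hd]
  field_simp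
  ring

theorem primitive_grad_eq_zero {y : ℝ} (hy : y ∉ Ioo p.a p.d) : primitive p.grad y = 0 := by
  by_cases hmem : y ∈ Icc (0 : ℝ) 1
  · rw [primitive_grad p hmem]
    obtain ⟨a, b, c, d, ha, hab, hbc, hcd, hd⟩ := p
    rcases le_or_gt y a with h | h
    · rw [min_eq_right h, min_eq_right (by order), min_eq_right (by order),
        min_eq_right (by order)]
      simp
    · have hdy : d ≤ y := not_lt.1 fun hlt => hy ⟨h, hlt⟩
      rw [min_eq_left hdy, min_eq_left (by order), min_eq_left (by order), min_eq_left (by order),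
        div_self (sub_ne_zero.2 hab.ne'), div_self (sub_ne_zero.2 hcd.ne'), sub_self]
  · exact primitive_eq_zero _ fun h => hmem (Ioo_subset_Icc_self h)

theorem primitive_grad_eq_one {y : ℝ} (hy : y ∈ Icc p.b p.c) : primitive p.grad y = 1 := by
  obtain ⟨a, b, c, d, ha, hab, hbc, hcd, hd⟩ := p
  have hby : b ≤ y := hy.1
  have hyc : y ≤ c := hy.2
  rw [primitive_grad _ ⟨by linarith, by linarith⟩]
  dsimp only
  rw [min_eq_left hby, min_eq_left (by order), min_eq_right hyc, min_eq_right (by order),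
    div_self (sub_ne_zero.2 hab.ne'), sub_self, zero_div, sub_zero]

theorem norm_grad_sq : ‖p.grad‖ ^ 2 = (p.b - p.a)⁻¹ + (p.d - p.c)⁻¹ := by
  rw [← real_inner_self_eq_norm_sq, inner_grad, slope_def_field, slope_def_field,
    primitive_grad_eq_one p ⟨le_rfl, p.b_le_c⟩, primitive_grad_eq_one p ⟨p.b_le_c, le_rfl⟩,
    primitive_grad_eq_zero p fun h => h.1.false, primitive_grad_eq_zero p fun h => h.2.false]
  ring

theorem measureReal_Icc_le_inner_greenOperator (ν : Measure ℝ) [IsFiniteMeasure ν] :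
    ν.real (Icc p.b p.c) ≤ inner ℝ (greenOperator ν p.grad) p.grad := by
  rw [inner_greenOperator, ← integral_indicator_one measurableSet_Icc]
  refine integral_mono ((integrable_const 1).indicator measurableSet_Icc)
    (integrable_primitive_mul ν _ _) (indicator_le' (fun y hy => ?_) fun y _ => mul_self_nonneg _)
  rw [p.primitive_grad_eq_one hy, mul_one, Pi.one_apply]

variable {p q}

theorem primitive_grad_mul_primitive_grad (h : Disjoint (Ioo p.a p.d) (Ioo q.a q.d)) (y : ℝ) :
    primitive p.grad y * primitive q.grad y = 0 := by
  by_cases hy : y ∈ Ioo p.a p.d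
  · rw [primitive_grad_eq_zero q (h.notMem_of_mem_left hy), mul_zero]
  · rw [primitive_grad_eq_zero p hy, zero_mul]

theorem inner_grad_grad (h : Disjoint (Ioo p.a p.d) (Ioo q.a q.d)) :
    inner ℝ p.grad q.grad = 0 := by
  have hab := p.a_lt_b
  have hbc := p.b_le_c
  have hcd := p.c_lt_d
  have hcl : Disjoint (Icc p.a p.d) (Ioo q.a q.d) := by
    simpa only [closure_Ioo (show p.a ≠ p.d by order)] using h.closure_left isOpen_Ioo
  have hzero : ∀ y, p.a ≤ y → y ≤ p.d → primitive q.grad y = 0 := fun y hay hyd =>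
    primitive_grad_eq_zero q (hcl.notMem_of_mem_left ⟨hay, hyd⟩)
  simp only [inner_grad, slope_def_field, hzero p.a le_rfl (by order),
    hzero p.b (by order) (by order), hzero p.c (by order) (by order), hzero p.d (by order) le_rfl,
    sub_self, zero_div]

end Trapezoid

theorem exists_affine_of_slope_eq {J : Set ℝ} {F : ℝ → ℝ}
    (h : ∀ c ∈ J, ∀ d ∈ J, ∀ m, c < m → m < d → slope F c m = slope F m d) :
    ∃ m c : ℝ, ∀ y ∈ J, F y = m * y + c := by
  rcases J.subsingleton_or_nontrivial with hJ | hJ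
  · obtain rfl | ⟨x, rfl⟩ := hJ.eq_empty_or_singleton
    · exact ⟨0, 0, fun y hy => hy.elim⟩
    · exact ⟨0, F x, fun y hy => by rw [mem_singleton_iff.1 hy]; ring⟩
  obtain ⟨p, hp, q, hq, hpq⟩ := hJ.exists_lt
  have hchord : ∀ c ∈ J, ∀ d ∈ J, ∀ m, c < m → m < d →
      (F m - F c) * (d - m) = (F d - F m) * (m - c) := by
    intro c hc d hd m hcm hmd
    have hslope := h c hc d hd m hcm hmd
    rwa [slope_def_field, slope_def_field,
      div_eq_div_iff (sub_ne_zero.2 hcm.ne') (sub_ne_zero.2 hmd.ne')] at hslope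
  refine ⟨slope F p q, F p - slope F p q * p, fun y hy => ?_⟩
  have hline : (F y - F p) * (q - p) = (F q - F p) * (y - p) := by
    rcases lt_trichotomy y p with hyp | rfl | hyp
    · linarith [hchord y hy q hq p hyp hpq]
    · ring
    rcases lt_trichotomy y q with hyq | rfl | hyq
    · linarith [hchord p hp q hq y hyp hyq]
    · ring
    · linarith [hchord p hp y hy q hpq hyq]
  have hqp : q - p ≠ 0 := sub_ne_zero.2 hpq.ne'
  rw [slope_def_field]
  field_simp
  linarith

section EigenvalueCount

/-- The span of the eigenfunctions with eigenvalues at most `x`. -/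
def lowEigenspan (ν : Measure ℝ) (x : ℝ) : Submodule ℝ (ℝ → ℝ) :=
  Submodule.span ℝ {f | ∃ l ≤ x, IsEigenfunction ν l f}

theorem eigenvalueCount_eq_rank (ν : Measure ℝ) (x : ℝ) :
    eigenvalueCount ν x = Cardinal.toENat (Module.rank ℝ (lowEigenspan ν x)) := rfl

variable {ν : Measure ℝ} [IsFiniteMeasure ν] {μ x : ℝ} {v : meanZero}

theorem inner_eq_of_greenOperator_eq_smul (hμ : 0 < μ) (hv : greenOperator ν v = μ • v)
    (h : meanZero) : inner ℝ v h = μ⁻¹ * ∫ x, primitive v x * primitive h x ∂ν := by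
  rw [← inner_greenOperator, hv, real_inner_smul_left, inv_mul_cancel_left₀ hμ.ne']

theorem isAffineOffSupport_primitive (hμ : 0 < μ) (hv : greenOperator ν v = μ • v) :
    IsAffineOffSupport ν (primitive v) := by
  intro x _
  have hsub := connectedComponentIn_subset (Icc (0 : ℝ) 1 \ ν.support) x
  refine exists_affine_of_slope_eq fun c hc d hd m hcm hmd => ?_
  let p : Trapezoid := ⟨c, m, m, d, (hsub hc).1.1, hcm, le_rfl, hmd, (hsub hd).1.2⟩
  have hcd : Icc c d ⊆ Icc 0 1 \ ν.support :=
    (isPreconnected_connectedComponentIn.ordConnected.out hc hd).trans hsub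
  have hzero : (fun y => primitive v y * primitive p.grad y) =ᵐ[ν] 0 := by
    filter_upwards [Measure.support_mem_ae (μ := ν)] with y hy
    rw [p.primitive_grad_eq_zero fun h => (hcd (Ioo_subset_Icc_self h)).2 hy, mul_zero,
      Pi.zero_apply]
  rw [← sub_eq_zero]
  calc slope (primitive v) c m - slope (primitive v) m d = inner ℝ v p.grad := by
        rw [real_inner_comm, p.inner_grad]
    _ = 0 := by
        rw [inner_eq_of_greenOperator_eq_smul hμ hv, integral_eq_zero_of_ae hzero, mul_zero]

theorem isEigenfunction_primitive (hμ : 0 < μ) (hv : greenOperator ν v = μ • v) (hv0 : v ≠ 0) :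
    IsEigenfunction ν μ⁻¹ (primitive v) := by
  refine ⟨⟨primitive_mem_H10 v, isAffineOffSupport_primitive hμ hv⟩,
    (map_ne_zero_iff primitive primitive_injective).2 hv0, fun g hg => ?_⟩
  obtain ⟨h, rfl⟩ := exists_primitive_eq hg.1
  rw [energy_primitive, inner_eq_of_greenOperator_eq_smul hμ hv]

theorem map_upperEigenspan_le_lowEigenspan (hx : 0 < x) :
    (upperEigenspan (greenOperator ν) x⁻¹).map primitive ≤ lowEigenspan ν x := by
  refine (Submodule.map_span_le _ _ _).2 ?_
  rintro v ⟨μ, hμ, hv⟩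
  have hμ0 : 0 < μ := (inv_pos.2 hx).trans_le hμ
  rcases eq_or_ne v 0 with rfl | hv0
  · rw [map_zero]
    exact Submodule.zero_mem _
  · exact Submodule.subset_span
      ⟨μ⁻¹, (inv_le_comm₀ hx hμ0).1 hμ, isEigenfunction_primitive hμ0 hv hv0⟩

theorem card_le_eigenvalueCount {ι : Type*} [Fintype ι] {p : ι → Trapezoid}
    (hp : Pairwise fun i j => Disjoint (Ioo (p i).a (p i).d) (Ioo (p j).a (p j).d)) (hx : 0 < x)
    (hlt : ∀ i, ((p i).b - (p i).a)⁻¹ + ((p i).d - (p i).c)⁻¹ <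
      x * ν.real (Icc (p i).b (p i).c)) :
    (Fintype.card ι : ℕ∞) ≤ eigenvalueCount ν x := by
  have hcard : (Fintype.card ι : Cardinal) ≤
      Module.rank ℝ (upperEigenspan (greenOperator ν) x⁻¹) := by
    refine card_le_rank_upperEigenspan (v := fun i => (p i).grad)
      (isCompactOperator_greenOperator ν) (isPositive_greenOperator ν).1
      (fun i j hij => Trapezoid.inner_grad_grad (hp hij)) (fun i j hij => ?_) fun i => ?_
    · simp only [inner_greenOperator, Trapezoid.primitive_grad_mul_primitive_grad (hp hij),
        integral_zero]
    · rw [(p i).norm_grad_sq, inv_mul_lt_iff₀ hx]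
      exact (hlt i).trans_le (mul_le_mul_of_nonneg_left
        ((p i).measureReal_Icc_le_inner_greenOperator ν) hx.le)
  have hrank := Submodule.rank_mono (map_upperEigenspan_le_lowEigenspan (ν := ν) hx)
  rw [rank_map_eq primitive_injective] at hrank
  have hcount := Cardinal.toENat.monotone' (hcard.trans hrank)
  rw [eigenvalueCount_eq_rank]
  simpa using hcount

theorem exists_norm_sq_le_of_mem_lowEigenspan {f : ℝ → ℝ} (hf : f ∈ lowEigenspan ν x) :
    ∃ g : meanZero, primitive g = f ∧ ‖g‖ ^ 2 ≤ x * ∫ y, f y ^ 2 ∂ν := by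
  obtain ⟨n, c, F, rfl⟩ := Submodule.mem_span_set'.1 hf
  choose l hl hF using fun i => (F i).2
  choose g hg using fun i => exists_primitive_eq (hF i).1.1
  have hinner : ∀ i j, inner ℝ (g i) (g j) = l i * inner ℝ (greenOperator ν (g i)) (g j) := by
    intro i j
    rw [← energy_primitive, inner_greenOperator, hg, hg, (hF i).2.2 _ (hF j).1]
  have hsum : primitive (∑ i, c i • g i) = ∑ i, c i • (F i : ℝ → ℝ) := by
    simp only [map_sum, map_smul, hg]
  refine ⟨∑ i, c i • g i, hsum, ?_⟩
  have hle := norm_sum_sq_le_of_inner_eq (isPositive_greenOperator ν) (g := fun i => c i • g i) hl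
    fun i j => by
      simp only [map_smul, real_inner_smul_left, real_inner_smul_right, hinner]
      ring
  simpa only [inner_greenOperator, hsum, ← sq] using hle

end EigenvalueCount

/-! ### Dyadic bisection -/

section DyadicCell

theorem measurableSet_dyadicCell (n k : ℕ) : MeasurableSet (dyadicCell n k) := measurableSet_Ioc

theorem disjoint_dyadicCell {n j k : ℕ} (h : j ≠ k) :
    Disjoint (dyadicCell n j) (dyadicCell n k) := by
  wlog hjk : j < k generalizing j k
  · exact (this h.symm (by lia)).symm
  rw [dyadicCell, dyadicCell, Ioc_disjoint_Ioc]
  refine (min_le_left _ _).trans (le_trans ?_ (le_max_right _ _))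
  gcongr
  exact_mod_cast hjk

theorem two_mul_div_two_pow_succ (n k : ℕ) :
    ((2 * k : ℕ) : ℝ) / 2 ^ (n + 1) = k / 2 ^ n := by
  push_cast
  rw [pow_succ]
  field_simp

theorem dyadicCell_eq_union (n k : ℕ) :
    dyadicCell n k = dyadicCell (n + 1) (2 * k) ∪ dyadicCell (n + 1) (2 * k + 1) := by
  have hright : (((2 * k + 1 : ℕ) : ℝ) + 1) / 2 ^ (n + 1) = (k + 1) / 2 ^ n := by
    have h := two_mul_div_two_pow_succ n (k + 1)
    push_cast at h ⊢
    rw [← h]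
    ring
  have hmid : ((2 * k : ℕ) + 1 : ℝ) = (2 * k + 1 : ℕ) := by push_cast; ring
  rw [dyadicCell, dyadicCell, dyadicCell, two_mul_div_two_pow_succ, hright, hmid,
    Ioc_union_Ioc_eq_Ioc]
  · rw [← two_mul_div_two_pow_succ]
    gcongr
    lia
  · rw [← hright]
    gcongr
    linarith

theorem cell_endpoints_mem {n k : ℕ} (hk : k < 2 ^ n) :
    (0 : ℝ) ≤ k / 2 ^ n ∧ ((k : ℝ) + 1) / 2 ^ n ≤ 1 := by
  refine ⟨by positivity, ?_⟩
  rw [div_le_one (by positivity)]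
  exact_mod_cast hk

theorem dyadicCell_subset {n k : ℕ} (hk : k < 2 ^ n) : dyadicCell n k ⊆ Ioc 0 1 :=
  Ioc_subset_Ioc (cell_endpoints_mem hk).1 (cell_endpoints_mem hk).2

theorem dyadicCell_zero_zero : dyadicCell 0 0 = Ioc 0 1 := by simp [dyadicCell]

theorem iUnion_dyadicCell (n : ℕ) : ⋃ k ∈ Finset.range (2 ^ n), dyadicCell n k = Ioc 0 1 := by
  induction n with
  | zero => simp [dyadicCell_zero_zero]
  | succ n ih =>
    rw [← ih]
    ext y
    simp only [dyadicCell_eq_union n, mem_iUnion, Finset.mem_range, mem_union]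
    constructor
    · rintro ⟨k, hk, hy⟩
      refine ⟨k / 2, by lia, ?_⟩
      rcases Nat.even_or_odd' k with ⟨j, rfl | rfl⟩
      · exact Or.inl (by rwa [Nat.mul_div_cancel_left j two_pos])
      · exact Or.inr (by rwa [show (2 * j + 1) / 2 = j by lia])
    · rintro ⟨k, hk, hy | hy⟩
      · exact ⟨2 * k, by lia, hy⟩
      · exact ⟨2 * k + 1, by lia, hy⟩

theorem abs_sub_le_of_mem_dyadicCell {n k : ℕ} {x y : ℝ} (hx : x ∈ dyadicCell n k)
    (hy : y ∈ dyadicCell n k) : |x - y| ≤ (2 ^ n)⁻¹ := by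
  have h := Real.dist_le_of_mem_Icc (Ioc_subset_Icc_self hx) (Ioc_subset_Icc_self hy)
  rwa [Real.dist_eq, ← sub_div, add_sub_cancel_left, one_div] at h

end DyadicCell

section UpperCount

theorem sq_integral_le_measureReal_mul_integral_sq {X : Type*} [MeasurableSpace X] {μ : Measure X}
    [IsFiniteMeasure μ] {g : X → ℝ} (hg : MemLp g 2 μ) :
    (∫ x, g x ∂μ) ^ 2 ≤ μ.real univ * ∫ x, g x ^ 2 ∂μ := by
  let one : Lp ℝ 2 μ := indicatorConstLp 2 MeasurableSet.univ (measure_ne_top _ _) 1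
  have hint : inner ℝ one (hg.toLp g) = ∫ x, g x ∂μ := by
    rw [L2.inner_indicatorConstLp_one, Measure.restrict_univ]
    exact integral_congr_ae hg.coeFn_toLp
  have hone : inner ℝ one one = μ.real univ := by
    rw [L2.real_inner_indicatorConstLp_one_indicatorConstLp_one, univ_inter]
  have hsq : inner ℝ (hg.toLp g) (hg.toLp g) = ∫ x, g x ^ 2 ∂μ := by
    rw [L2.inner_def]
    refine integral_congr_ae ?_
    filter_upwards [hg.coeFn_toLp] with x hx
    rw [hx, real_inner_self_eq_norm_sq, Real.norm_eq_abs, sq_abs]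
  rw [← hint, ← hone, ← hsq, sq]
  exact real_inner_mul_inner_self_le _ _

theorem memLp_restrict_Ioc (g : Lp ℝ 2 unitVolume) :
    MemLp g 2 (volume.restrict (Ioc (0 : ℝ) 1)) := by
  rw [← Measure.restrict_congr_set Ioo_ae_eq_Ioc]
  exact Lp.memLp g

theorem norm_sq_eq_setIntegral (g : Lp ℝ 2 unitVolume) :
    ‖g‖ ^ 2 = ∫ y in Ioc (0 : ℝ) 1, g y ^ 2 := by
  rw [← real_inner_self_eq_norm_sq, L2.inner_def, integral_Ioc_eq_integral_Ioo]
  simp only [real_inner_self_eq_norm_sq, Real.norm_eq_abs, sq_abs]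

variable {ν : Measure ℝ} [IsFiniteMeasure ν] {g : meanZero} {t x : ℝ} {n k : ℕ}

theorem setIntegral_primitive_sq_le {a b : ℝ} (ha : 0 ≤ a) (hb : b ≤ 1) (h0 : primitive g a = 0) :
    ∫ y in Ioc a b, primitive g y ^ 2 ∂ν ≤
      ν.real (Ioc a b) * ((b - a) * ∫ y in Ioc a b, (g : Lp ℝ 2 unitVolume) y ^ 2) := by
  have hpt : ∀ y ∈ Ioc a b,
      primitive g y ^ 2 ≤ (b - a) * ∫ s in Ioc a b, (g : Lp ℝ 2 unitVolume) s ^ 2 := by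
    rintro y ⟨hay, hyb⟩
    have hLp : ∀ c ≤ 1, MemLp (g : Lp ℝ 2 unitVolume) 2 (volume.restrict (Ioc a c)) := fun c hc =>
      (memLp_restrict_Ioc g).mono_measure (Measure.restrict_mono_set _ (Ioc_subset_Ioc ha hc))
    have hprim : primitive g y = ∫ s in Ioc a y, (g : Lp ℝ 2 unitVolume) s := by
      rw [← intervalIntegral.integral_of_le hay.le, ← primitive_sub_primitive g
        ⟨ha, by linarith⟩ ⟨by linarith, by linarith⟩, h0, sub_zero]
    calc primitive g y ^ 2
        ≤ (y - a) * ∫ s in Ioc a y, (g : Lp ℝ 2 unitVolume) s ^ 2 := by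
          have h := sq_integral_le_measureReal_mul_integral_sq (hLp y (hyb.trans hb))
          rwa [← hprim, measureReal_restrict_apply_univ, Real.volume_real_Ioc_of_le hay.le] at h
      _ ≤ (b - a) * ∫ s in Ioc a b, (g : Lp ℝ 2 unitVolume) s ^ 2 := by
          refine mul_le_mul (by linarith) (setIntegral_mono_set (hLp b hb).integrable_sq
            (ae_of_all _ fun _ => sq_nonneg _) (Ioc_subset_Ioc_right hyb).eventuallyLE)
            (integral_nonneg fun _ => sq_nonneg _) (by linarith)
  rw [← smul_eq_mul (ν.real _), ← setIntegral_const]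
  exact setIntegral_mono_on (integrable_primitive_sq ν g).integrableOn (integrable_const _)
    measurableSet_Ioc hpt

theorem setIntegral_primitive_sq_le_of_light (hk : k < 2 ^ n) (h0 : primitive g (k / 2 ^ n) = 0)
    (hle : ν.real (dyadicCell n k) ≤ t * 2 ^ n) :
    ∫ y in dyadicCell n k, primitive g y ^ 2 ∂ν ≤
      t * ∫ y in dyadicCell n k, (g : Lp ℝ 2 unitVolume) y ^ 2 := by
  refine (setIntegral_primitive_sq_le (cell_endpoints_mem hk).1 (cell_endpoints_mem hk).2
    h0).trans ?_
  rw [← mul_assoc, ← sub_div, add_sub_cancel_left, mul_one_div]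
  exact mul_le_mul_of_nonneg_right ((div_le_iff₀ (by positivity)).2 hle)
    (integral_nonneg fun _ => sq_nonneg _)

/-- Bisecting the cells `C` with `ν(C) Λ(C) > t` ends after finitely many steps, since `ν` is
finite. -/
theorem setIntegral_primitive_sq_le_of_midpoint_eq_zero (ht : 0 < t)
    (hz : ∀ n k : ℕ, k < 2 ^ n → t * 2 ^ n < ν.real (dyadicCell n k) →
      primitive g ((2 * k + 1 : ℕ) / 2 ^ (n + 1)) = 0)
    (hk : k < 2 ^ n) (h0 : primitive g (k / 2 ^ n) = 0) :
    ∫ y in dyadicCell n k, primitive g y ^ 2 ∂ν ≤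
      t * ∫ y in dyadicCell n k, (g : Lp ℝ 2 unitVolume) y ^ 2 := by
  obtain ⟨N, hN⟩ := pow_unbounded_of_one_lt (ν.real univ / t) (one_lt_two (α := ℝ))
  rw [div_lt_iff₀' ht] at hN
  obtain ⟨j, hj⟩ : ∃ j, N ≤ n + j := ⟨N, by lia⟩
  induction j generalizing n k with
  | zero =>
    refine setIntegral_primitive_sq_le_of_light hk h0 ?_
    calc ν.real (dyadicCell n k) ≤ ν.real univ := measureReal_mono (subset_univ _)
      _ ≤ t * 2 ^ N := hN.le
      _ ≤ t * 2 ^ n := by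
        gcongr
        · exact one_le_two
        · exact hj
  | succ j ih =>
    rcases le_or_gt (ν.real (dyadicCell n k)) (t * 2 ^ n) with hlight | hheavy
    · exact setIntegral_primitive_sq_le_of_light hk h0 hlight
    have hkl : 2 * k < 2 ^ (n + 1) := by lia
    have hkr : 2 * k + 1 < 2 ^ (n + 1) := by lia
    have hleft := ih hkl (by rw [two_mul_div_two_pow_succ, h0]) (by lia)
    have hright := ih hkr (hz n k hk hheavy) (by lia)
    have hdisj := disjoint_dyadicCell (n := n + 1) (j := 2 * k) (k := 2 * k + 1) (by lia)
    have hi := (integrable_primitive_sq ν g).integrableOn (s := dyadicCell (n + 1) (2 * k))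
    have hg : IntegrableOn (fun y => (g : Lp ℝ 2 unitVolume) y ^ 2) (Ioc 0 1) :=
      (memLp_restrict_Ioc g).integrable_sq
    rw [dyadicCell_eq_union, setIntegral_union hdisj (measurableSet_dyadicCell _ _) hi
      (integrable_primitive_sq ν g).integrableOn, setIntegral_union hdisj
      (measurableSet_dyadicCell _ _) (hg.mono_set (dyadicCell_subset hkl))
      (hg.mono_set (dyadicCell_subset hkr)), mul_add]
    exact add_le_add hleft hright

theorem eq_zero_of_midpoint_eq_zero (hsupp : ν (Ioo (0 : ℝ) 1)ᶜ = 0) (ht : 0 < t) (hxt : x * t < 1)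
    (hz : ∀ n k : ℕ, k < 2 ^ n → t * 2 ^ n < ν.real (dyadicCell n k) →
      primitive g ((2 * k + 1 : ℕ) / 2 ^ (n + 1)) = 0)
    (hle : ‖g‖ ^ 2 ≤ x * ∫ y, primitive g y ^ 2 ∂ν) : g = 0 := by
  have hν : ν.restrict (Ioc (0 : ℝ) 1) = ν :=
    Measure.restrict_eq_self_of_ae_mem <| mem_ae_iff.2 <|
      measure_mono_null (compl_subset_compl.2 Ioo_subset_Ioc_self) hsupp
  have hint : ∫ y, primitive g y ^ 2 ∂ν ≤ t * ‖g‖ ^ 2 := by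
    have h := setIntegral_primitive_sq_le_of_midpoint_eq_zero ht hz (n := 0) (k := 0) (by simp)
      (primitive_eq_zero g (by simp))
    rwa [dyadicCell_zero_zero, hν, ← norm_sq_eq_setIntegral] at h
  have hnonneg : 0 ≤ ∫ y, primitive g y ^ 2 ∂ν := integral_nonneg fun _ => sq_nonneg _
  by_contra hg
  have hpos : 0 < ‖g‖ ^ 2 := by positivity
  rcases le_or_gt x 0 with hx | hx
  · nlinarith
  · nlinarith [mul_le_mul_of_nonneg_left hint hx.le]

theorem eigenvalueCount_le_card (hsupp : ν (Ioo (0 : ℝ) 1)ᶜ = 0) (ht : 0 < t) (hxt : x * t < 1)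
    (s : Finset (ℕ × ℕ))
    (hs : ∀ n k : ℕ, k < 2 ^ n → t * 2 ^ n < ν.real (dyadicCell n k) → (n, k) ∈ s) :
    eigenvalueCount ν x ≤ s.card := by
  let evalMidpoints : (ℝ → ℝ) →ₗ[ℝ] (s → ℝ) :=
    LinearMap.pi fun p => LinearMap.proj (((2 * p.1.2 + 1 : ℕ) : ℝ) / 2 ^ (p.1.1 + 1))
  have hinj : Function.Injective (evalMidpoints.domRestrict (lowEigenspan ν x)) := by
    refine (injective_iff_map_eq_zero _).2 ?_
    rintro ⟨f, hf⟩ hzero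
    obtain ⟨g, rfl, hle⟩ := exists_norm_sq_le_of_mem_lowEigenspan hf
    have hg : g = 0 := eq_zero_of_midpoint_eq_zero hsupp ht hxt
      (fun n k hk h => congrFun hzero ⟨(n, k), hs n k hk h⟩) hle
    exact Subtype.ext (by simp [hg])
  have hcount := Cardinal.toENat.monotone' (LinearMap.rank_le_of_injective _ hinj)
  rw [eigenvalueCount_eq_rank]
  simpa using hcount

end UpperCount

/-! ### Growth exponents -/

section LogQuotient

theorem log_div_log_le_iff {u : ℝ≥0∞} {b c : ℝ} (hb : 1 < b) :
    ENNReal.log u / (Real.log b : EReal) ≤ c ↔ u ≤ ENNReal.ofReal (b ^ c) := by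
  have hb0 : 0 < b := one_pos.trans hb
  rw [EReal.div_le_iff_le_mul (by exact_mod_cast Real.log_pos hb) (EReal.coe_ne_top _),
    ← EReal.coe_mul, mul_comm, ← Real.log_rpow hb0,
    ← ENNReal.log_ofReal_of_pos (Real.rpow_pos_of_pos hb0 c), ENNReal.log_le_log_iff]

theorem le_log_div_log_iff {u : ℝ≥0∞} {b c : ℝ} (hb : 1 < b) :
    (c : EReal) ≤ ENNReal.log u / (Real.log b : EReal) ↔ ENNReal.ofReal (b ^ c) ≤ u := by
  have hb0 : 0 < b := one_pos.trans hb
  rw [EReal.le_div_iff_mul_le (by exact_mod_cast Real.log_pos hb) (EReal.coe_ne_top _),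
    ← EReal.coe_mul, ← Real.log_rpow hb0,
    ← ENNReal.log_ofReal_of_pos (Real.rpow_pos_of_pos hb0 c), ENNReal.log_le_log_iff]

variable {α : Type*} {l : Filter α} {u : α → ℝ≥0∞} {b : α → ℝ} {A c : ℝ}

theorem eventually_mul_rpow_le_rpow {c' : ℝ} (hb : Tendsto b l atTop) (A : ℝ) (hc : c < c') :
    ∀ᶠ a in l, A * b a ^ c ≤ b a ^ c' := by
  have hgap := (tendsto_rpow_atTop (sub_pos.2 hc)).comp hb
  filter_upwards [hb.eventually_gt_atTop 0, hgap.eventually_ge_atTop A] with a ha hA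
  calc A * b a ^ c ≤ b a ^ (c' - c) * b a ^ c := by gcongr; exact hA
    _ = b a ^ c' := by rw [← Real.rpow_add ha, sub_add_cancel]

theorem limsup_log_div_log_le (hb : Tendsto b l atTop)
    (h : ∀ᶠ a in l, u a ≤ ENNReal.ofReal (A * b a ^ c)) :
    limsup (fun a => ENNReal.log (u a) / (Real.log (b a) : EReal)) l ≤ c := by
  refine EReal.le_of_forall_lt_iff_le.1 fun c' hc => limsup_le_of_le (by isBoundedDefault) ?_
  filter_upwards [h, hb.eventually_gt_atTop 1,
    eventually_mul_rpow_le_rpow hb A (EReal.coe_lt_coe_iff.1 hc)] with a hu hb hA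
  exact (log_div_log_le_iff hb).2 (hu.trans (ENNReal.ofReal_le_ofReal hA))

theorem le_liminf_log_div_log (hA : 0 < A) (hb : Tendsto b l atTop)
    (h : ∀ᶠ a in l, ENNReal.ofReal (A * b a ^ c) ≤ u a) :
    (c : EReal) ≤ liminf (fun a => ENNReal.log (u a) / (Real.log (b a) : EReal)) l := by
  refine EReal.ge_of_forall_gt_iff_ge.1 fun c' hc => le_liminf_of_le (by isBoundedDefault) ?_
  filter_upwards [h, hb.eventually_gt_atTop 1,
    eventually_mul_rpow_le_rpow hb A⁻¹ (EReal.coe_lt_coe_iff.1 hc)] with a hu hb hgap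
  refine (le_log_div_log_iff hb).2 (le_trans (ENNReal.ofReal_le_ofReal ?_) hu)
  rwa [← inv_mul_le_iff₀ hA]

theorem eventually_le_of_limsup_log_div_log_lt (hb : Tendsto b l atTop)
    (h : limsup (fun a => ENNReal.log (u a) / (Real.log (b a) : EReal)) l < c) :
    ∀ᶠ a in l, u a ≤ ENNReal.ofReal (b a ^ c) := by
  filter_upwards [eventually_lt_of_limsup_lt h, hb.eventually_gt_atTop 1] with a hu hb
  exact (log_div_log_le_iff hb).1 hu.le

end LogQuotient

open Classical in
/-- The indices of the dyadic cells of level `n` that are charged by `ν`. -/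
def posCells (ν : Measure ℝ) (n : ℕ) : Finset ℕ :=
  (Finset.range (2 ^ n)).filter fun k => 0 < ν (dyadicCell n k)

/-- The partition sum `∑ ν(C)^q` over the charged dyadic cells of level `n`. -/
def powSum (ν : Measure ℝ) (n : ℕ) (q : ℝ) : ℝ :=
  ∑ k ∈ posCells ν n, ν.real (dyadicCell n k) ^ q

/-- The partition sums `∑ ν(C)^q` are `O(2^(n c))`. The infimum of these `c` is `lqSpectrum ν q`. -/
def HasGrowth (ν : Measure ℝ) (q c : ℝ) : Prop :=
  ∃ A > 0, ∀ n : ℕ, powSum ν n q ≤ A * (2 : ℝ) ^ ((n : ℝ) * c)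

section Growth

variable {ν : Measure ℝ} {n k : ℕ} {q c : ℝ}

theorem mem_posCells : k ∈ posCells ν n ↔ k < 2 ^ n ∧ 0 < ν (dyadicCell n k) := by
  simp [posCells]

theorem posCells_subset_range (ν : Measure ℝ) (n : ℕ) : posCells ν n ⊆ Finset.range (2 ^ n) :=
  Finset.filter_subset _ _

theorem powSum_zero (ν : Measure ℝ) (n : ℕ) : powSum ν n 0 = (posCells ν n).card := by
  simp [powSum]

theorem powSum_nonneg (ν : Measure ℝ) (n : ℕ) (q : ℝ) : 0 ≤ powSum ν n q :=
  Finset.sum_nonneg fun _ _ => Real.rpow_nonneg measureReal_nonneg _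

theorem tendsto_mul_two_rpow_of_neg (A : ℝ) (hc : c < 0) :
    Tendsto (fun n : ℕ => A * (2 : ℝ) ^ ((n : ℝ) * c)) atTop (𝓝 0) := by
  have hgeom := (tendsto_pow_atTop_nhds_zero_of_lt_one (r := (2 : ℝ) ^ c) (by positivity)
    (Real.rpow_lt_one_of_one_lt_of_neg one_lt_two hc)).const_mul A
  rw [mul_zero] at hgeom
  refine hgeom.congr fun n => ?_
  rw [← Real.rpow_natCast, ← Real.rpow_mul zero_le_two, mul_comm c]

theorem hasGrowth_of_eventually {K : ℝ} (hK : 0 < K)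
    (h : ∀ᶠ n : ℕ in atTop, powSum ν n q ≤ K * (2 : ℝ) ^ ((n : ℝ) * c)) : HasGrowth ν q c := by
  obtain ⟨N, hN⟩ := eventually_atTop.1 h
  set r : ℕ → ℝ := fun n => powSum ν n q / (2 : ℝ) ^ ((n : ℝ) * c)
  have hr0 : ∀ n, 0 ≤ r n := fun n => div_nonneg (powSum_nonneg ν n q) (by positivity)
  have hsum : 0 ≤ ∑ n ∈ Finset.range N, r n := Finset.sum_nonneg fun n _ => hr0 n
  refine ⟨K + ∑ n ∈ Finset.range N, r n, by linarith, fun n => ?_⟩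
  have hp : (0 : ℝ) < (2 : ℝ) ^ ((n : ℝ) * c) := by positivity
  rw [← div_le_iff₀ hp]
  rcases le_or_gt N n with hn | hn
  · linarith [(div_le_iff₀ hp).2 (hN n hn)]
  · have : r n ≤ ∑ n ∈ Finset.range N, r n :=
      Finset.single_le_sum (fun n _ => hr0 n) (Finset.mem_range.2 hn)
    exact this.trans (by linarith)

theorem hasGrowth_zero_one (ν : Measure ℝ) : HasGrowth ν 0 1 := by
  refine ⟨1, one_pos, fun n => ?_⟩
  rw [powSum_zero, one_mul, mul_one, Real.rpow_natCast]
  exact_mod_cast (Finset.card_le_card (posCells_subset_range ν n)).trans_eq (Finset.card_range _)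

theorem measureReal_univ_eq (hsupp : ν (Ioo (0 : ℝ) 1)ᶜ = 0) : ν.real univ = ν.real (Ioc 0 1) := by
  refine (measureReal_congr (eventuallyEq_univ.2 (mem_ae_iff.2 ?_))).symm
  exact measure_mono_null (compl_subset_compl.2 Ioo_subset_Ioc_self) hsupp

variable [IsFiniteMeasure ν]

theorem measureReal_pos_of_mem_posCells (hk : k ∈ posCells ν n) : 0 < ν.real (dyadicCell n k) :=
  ENNReal.toReal_pos (mem_posCells.1 hk).2.ne' (measure_ne_top _ _)

theorem powSum_le_rpow_mul_rpow (n : ℕ) {q₀ q₁ a b : ℝ} (ha : 0 < a) (hb : 0 < b)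
    (hab : a + b = 1) :
    powSum ν n (a * q₀ + b * q₁) ≤ powSum ν n q₀ ^ a * powSum ν n q₁ ^ b := by
  have hconj : (a⁻¹).HolderConjugate b⁻¹ := by
    rw [Real.holderConjugate_iff, inv_inv, inv_inv]
    exact ⟨(one_lt_inv₀ ha).2 (by linarith), hab⟩
  have hroot : ∀ {s : ℝ}, 0 < s → ∀ q, powSum ν n q =
      ∑ k ∈ posCells ν n, (ν.real (dyadicCell n k) ^ (s * q)) ^ s⁻¹ := fun hs q =>
    Finset.sum_congr rfl fun k _ => by
      rw [← Real.rpow_mul measureReal_nonneg, mul_right_comm, mul_inv_cancel₀ hs.ne', one_mul]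
  have hHolder := Real.inner_le_Lp_mul_Lq_of_nonneg (posCells ν n) hconj
    (f := fun k => ν.real (dyadicCell n k) ^ (a * q₀))
    (g := fun k => ν.real (dyadicCell n k) ^ (b * q₁))
    (fun _ _ => Real.rpow_nonneg measureReal_nonneg _)
    (fun _ _ => Real.rpow_nonneg measureReal_nonneg _)
  rw [← hroot ha, ← hroot hb] at hHolder
  simp only [one_div, inv_inv] at hHolder
  refine le_trans (le_of_eq ?_) hHolder
  exact Finset.sum_congr rfl fun k hk =>
    Real.rpow_add (measureReal_pos_of_mem_posCells hk) _ _

theorem HasGrowth.convex {q₀ q₁ c₀ c₁ a b : ℝ} (h₀ : HasGrowth ν q₀ c₀) (h₁ : HasGrowth ν q₁ c₁)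
    (ha : 0 < a) (hb : 0 < b) (hab : a + b = 1) :
    HasGrowth ν (a * q₀ + b * q₁) (a * c₀ + b * c₁) := by
  obtain ⟨A, hA, h₀⟩ := h₀
  obtain ⟨B, hB, h₁⟩ := h₁
  refine ⟨A ^ a * B ^ b, by positivity, fun n => ?_⟩
  calc powSum ν n (a * q₀ + b * q₁) ≤ powSum ν n q₀ ^ a * powSum ν n q₁ ^ b :=
        powSum_le_rpow_mul_rpow n ha hb hab
    _ ≤ (A * (2 : ℝ) ^ ((n : ℝ) * c₀)) ^ a * (B * (2 : ℝ) ^ ((n : ℝ) * c₁)) ^ b := by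
        have := powSum_nonneg ν n q₀
        have := powSum_nonneg ν n q₁
        gcongr
        · exact h₀ n
        · exact h₁ n
    _ = A ^ a * B ^ b * (2 : ℝ) ^ (n * (a * c₀ + b * c₁)) := by
        rw [Real.mul_rpow hA.le (by positivity), Real.mul_rpow hB.le (by positivity),
          ← Real.rpow_mul zero_le_two, ← Real.rpow_mul zero_le_two, mul_mul_mul_comm,
          ← Real.rpow_add two_pos]
        ring_nf

section Support

variable (hsupp : ν (Ioo (0 : ℝ) 1)ᶜ = 0)
include hsupp

theorem powSum_one (n : ℕ) : powSum ν n 1 = ν.real univ := by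
  rw [measureReal_univ_eq hsupp, ← iUnion_dyadicCell n, measureReal_biUnion_finset
    (fun i _ j _ hij => disjoint_dyadicCell hij) (fun k _ => measurableSet_dyadicCell n k), powSum]
  simp only [Real.rpow_one]
  refine Finset.sum_subset (posCells_subset_range ν n) fun k hk hk' => ?_
  rw [mem_posCells, not_and, not_lt, nonpos_iff_eq_zero] at hk'
  rw [measureReal_def, hk' (Finset.mem_range.1 hk), ENNReal.toReal_zero]

variable [NeZero ν]

theorem posCells_nonempty (n : ℕ) : (posCells ν n).Nonempty := by
  rw [Finset.nonempty_iff_ne_empty]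
  intro h
  have hone := powSum_one hsupp n
  rw [powSum, h, Finset.sum_empty] at hone
  exact measureReal_univ_pos.ne hone

theorem powSum_pos (n : ℕ) (q : ℝ) : 0 < powSum ν n q :=
  Finset.sum_pos (fun _ hk => Real.rpow_pos_of_pos (measureReal_pos_of_mem_posCells hk) _)
    (posCells_nonempty hsupp n)

theorem lqSpectrum_eq (q : ℝ) : lqSpectrum ν q =
    limsup (fun n : ℕ => ENNReal.log (ENNReal.ofReal (powSum ν n q)) /
      (Real.log ((2 : ℝ) ^ n) : EReal)) atTop := by
  refine congrArg (limsup · atTop) (funext fun n => ?_)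
  rw [ENNReal.log_ofReal_of_pos (powSum_pos hsupp n q), ← EReal.coe_div, lqSpectrumAt,
    one_div_mul_eq_div]
  rfl

theorem hasGrowth_of_lqSpectrum_lt (h : lqSpectrum ν q < (c : EReal)) : HasGrowth ν q c := by
  rw [lqSpectrum_eq hsupp] at h
  refine hasGrowth_of_eventually one_pos ?_
  filter_upwards [eventually_le_of_limsup_log_div_log_lt
    (tendsto_pow_atTop_atTop_of_one_lt one_lt_two) h] with n hn
  rw [ENNReal.ofReal_le_ofReal_iff (by positivity)] at hn
  rwa [one_mul, Real.rpow_mul zero_le_two, Real.rpow_natCast]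

theorem HasGrowth.lqSpectrum_le (h : HasGrowth ν q c) : lqSpectrum ν q ≤ (c : EReal) := by
  obtain ⟨A, -, h⟩ := h
  rw [lqSpectrum_eq hsupp]
  refine limsup_log_div_log_le (A := A) (tendsto_pow_atTop_atTop_of_one_lt one_lt_two)
    (Eventually.of_forall fun n => ENNReal.ofReal_le_ofReal ?_)
  rw [← Real.rpow_natCast, ← Real.rpow_mul zero_le_two]
  exact h n

theorem le_lqSpectrum {b : ℝ} (h : ∀ c, HasGrowth ν q c → b ≤ c) :
    (b : EReal) ≤ lqSpectrum ν q := by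
  by_contra! hlt
  obtain ⟨c, hqc, hcb⟩ := EReal.lt_iff_exists_real_btwn.1 hlt
  exact (h c (hasGrowth_of_lqSpectrum_lt hsupp hqc)).not_gt (EReal.coe_lt_coe_iff.1 hcb)

theorem hasGrowth_one_zero : HasGrowth ν 1 0 :=
  ⟨ν.real univ, measureReal_univ_pos, fun n => by simp [powSum_one hsupp]⟩

theorem HasGrowth.nonneg_of_one (h : HasGrowth ν 1 c) : 0 ≤ c := by
  by_contra! hc
  obtain ⟨A, -, h⟩ := h
  refine (ge_of_tendsto' (tendsto_mul_two_rpow_of_neg A hc) fun n => ?_).not_gt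
    (measureReal_univ_pos (μ := ν))
  rw [← powSum_one hsupp n]
  exact h n

theorem hasGrowth_of_one_le (hq : 1 ≤ q) : HasGrowth ν q 0 := by
  have hM : 0 < ν.real univ := measureReal_univ_pos
  refine ⟨ν.real univ ^ (q - 1) * ν.real univ, by positivity, fun n => ?_⟩
  rw [mul_zero, Real.rpow_zero, mul_one]
  calc powSum ν n q
      = ∑ k ∈ posCells ν n, ν.real (dyadicCell n k) ^ (q - 1) * ν.real (dyadicCell n k) ^ (1 : ℝ) :=
        Finset.sum_congr rfl fun k hk => by
          rw [← Real.rpow_add (measureReal_pos_of_mem_posCells hk), sub_add_cancel]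
    _ ≤ ∑ k ∈ posCells ν n, ν.real univ ^ (q - 1) * ν.real (dyadicCell n k) ^ (1 : ℝ) := by
        gcongr
        · finiteness
        · exact subset_univ _
    _ = ν.real univ ^ (q - 1) * ν.real univ := by
        rw [← Finset.mul_sum, ← powSum, powSum_one hsupp]

theorem hasGrowth_of_le_one (h0 : 0 ≤ q) (h1 : q ≤ 1) : HasGrowth ν q (1 - q) := by
  rcases h0.eq_or_lt with rfl | h0
  · simpa using hasGrowth_zero_one ν
  rcases h1.eq_or_lt with rfl | h1
  · simpa using hasGrowth_one_zero hsupp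
  simpa using (hasGrowth_zero_one ν).convex (hasGrowth_one_zero hsupp) (sub_pos.2 h1) h0 (by ring)

theorem HasGrowth.nonneg_of_le_one (h : HasGrowth ν q c) (hq : q ≤ 1) : 0 ≤ c := by
  rcases hq.eq_or_lt with rfl | hq
  · exact h.nonneg_of_one hsupp
  have hq2 : 0 < 2 - q := by linarith
  have hone := h.convex (hasGrowth_of_one_le hsupp one_le_two) (a := 1 / (2 - q))
    (b := (1 - q) / (2 - q)) (by positivity) (div_pos (by linarith) hq2) (by field_simp; ring)
  rw [show 1 / (2 - q) * q + (1 - q) / (2 - q) * 2 = 1 by field_simp; ring, mul_zero,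
    add_zero] at hone
  exact nonneg_of_mul_nonneg_right (hone.nonneg_of_one hsupp) (by positivity)

theorem HasGrowth.one_sub_le (h : HasGrowth ν q c) (hq : 1 ≤ q) : 1 - q ≤ c := by
  rcases hq.eq_or_lt with rfl | hq
  · simpa using h.nonneg_of_one hsupp
  have hq0 : 0 < q := by linarith
  have hone := h.convex (hasGrowth_zero_one ν) (a := 1 / q) (b := (q - 1) / q) (by positivity)
    (div_pos (by linarith) hq0) (by field_simp; ring)
  rw [show 1 / q * q + (q - 1) / q * 0 = 1 by field_simp; ring] at hone
  have hnn : 0 ≤ (c + (q - 1)) / q := (hone.nonneg_of_one hsupp).trans_eq (by ring)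
  rw [le_div_iff₀ hq0] at hnn
  linarith

end Support

end Growth

/-- The `L^q`-spectrum as a real function. It takes the junk value `0` where `lqSpectrum` is
infinite, which does not happen for `0 ≤ q`. -/
def lqReal (ν : Measure ℝ) (q : ℝ) : ℝ := (lqSpectrum ν q).toReal

section LqReal

variable {ν : Measure ℝ} [IsFiniteMeasure ν] [NeZero ν] {q c : ℝ}
  (hsupp : ν (Ioo (0 : ℝ) 1)ᶜ = 0)
include hsupp

theorem coe_lqReal (hq : 0 ≤ q) : (lqReal ν q : EReal) = lqSpectrum ν q := by
  rcases le_total q 1 with h | h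
  · exact EReal.coe_toReal
      (ne_top_of_le_ne_top (EReal.coe_ne_top _)
        ((hasGrowth_of_le_one hsupp hq h).lqSpectrum_le hsupp))
      (ne_bot_of_le_ne_bot (EReal.coe_ne_bot _)
        (le_lqSpectrum hsupp fun _ hc => hc.nonneg_of_le_one hsupp h))
  · exact EReal.coe_toReal
      (ne_top_of_le_ne_top (EReal.coe_ne_top _) ((hasGrowth_of_one_le hsupp h).lqSpectrum_le hsupp))
      (ne_bot_of_le_ne_bot (EReal.coe_ne_bot _)
        (le_lqSpectrum hsupp fun _ hc => hc.one_sub_le hsupp h))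

theorem hasGrowth_of_lqReal_lt (hq : 0 ≤ q) (h : lqReal ν q < c) : HasGrowth ν q c :=
  hasGrowth_of_lqSpectrum_lt hsupp (by rwa [← coe_lqReal hsupp hq, EReal.coe_lt_coe_iff])

theorem HasGrowth.lqReal_le (h : HasGrowth ν q c) (hq : 0 ≤ q) : lqReal ν q ≤ c := by
  have := h.lqSpectrum_le hsupp
  rwa [← coe_lqReal hsupp hq, EReal.coe_le_coe_iff] at this

theorem le_lqReal {b : ℝ} (hq : 0 ≤ q) (h : ∀ c, HasGrowth ν q c → b ≤ c) : b ≤ lqReal ν q := by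
  have := le_lqSpectrum hsupp h
  rwa [← coe_lqReal hsupp hq, EReal.coe_le_coe_iff] at this

theorem lqReal_one : lqReal ν 1 = 0 :=
  le_antisymm ((hasGrowth_one_zero hsupp).lqReal_le hsupp zero_le_one)
    (le_lqReal hsupp zero_le_one fun _ hc => hc.nonneg_of_one hsupp)

theorem convexOn_lqReal : ConvexOn ℝ (Ici 0) (lqReal ν) := by
  rw [convexOn_iff_forall_pos]
  refine ⟨convex_Ici 0, fun q₀ h₀ q₁ h₁ a b ha hb hab => ?_⟩
  refine le_of_forall_pos_le_add fun ε hε => ?_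
  have hgrowth := (hasGrowth_of_lqReal_lt hsupp h₀ (lt_add_of_pos_right _ hε)).convex
    (hasGrowth_of_lqReal_lt hsupp h₁ (lt_add_of_pos_right _ hε)) ha hb hab
  refine (hgrowth.lqReal_le hsupp (add_nonneg (mul_nonneg ha.le h₀) (mul_nonneg hb.le h₁))).trans_eq
    ?_
  simp only [smul_eq_mul]
  linear_combination ε * hab

end LqReal

/-! ### The Minkowski dimension of the support -/

section Covering

variable {ν : Measure ℝ} {n k : ℕ} {ε : ℝ}

theorem exists_mem_posCells_inter_nonempty (hsupp : ν (Ioo (0 : ℝ) 1)ᶜ = 0) (n : ℕ) {s : Set ℝ}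
    (hs : ν s ≠ 0) : ∃ k ∈ posCells ν n, (dyadicCell n k ∩ s).Nonempty := by
  have hcell : ν (s ∩ Ioc 0 1) ≠ 0 := by
    rwa [measure_inter_conull
      (measure_mono_null (compl_subset_compl.2 Ioo_subset_Ioc_self) hsupp)]
  rw [← iUnion_dyadicCell n, inter_iUnion₂] at hcell
  have hnull := (measure_biUnion_null_iff (Finset.countable_toSet _)).not.1 hcell
  push Not at hnull
  obtain ⟨k, hk, hpos⟩ := hnull
  rw [inter_comm] at hpos
  exact ⟨k, mem_posCells.2 ⟨Finset.mem_range.1 hk,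
    (pos_iff_ne_zero.2 hpos).trans_le (measure_mono inter_subset_left)⟩,
    nonempty_of_measure_ne_zero hpos⟩

theorem coveringNumber_le_card_posCells (hsupp : ν (Ioo (0 : ℝ) 1)ᶜ = 0)
    (hε : 2 * (2 ^ n)⁻¹ ≤ ε) :
    Metric.coveringNumber ε.toNNReal ν.support ≤ (posCells ν n).card := by
  classical
  have hcell : ∀ k ∈ posCells ν n, (dyadicCell n k ∩ ν.support).Nonempty := fun k hk =>
    Measure.nonempty_inter_support_of_pos (mem_posCells.1 hk).2
  choose! p hp using hcell
  have hsub : ((posCells ν n).image p : Set ℝ) ⊆ ν.support := by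
    simpa [subset_def] using fun k hk => (hp k hk).2
  have hcover : Metric.IsCover ε.toNNReal ν.support ((posCells ν n).image p : Set ℝ) := by
    rw [Metric.isCover_iff_subset_iUnion_closedBall]
    intro x hx
    have hball := (Measure.mem_support_iff_forall x).1 hx _
      (Metric.ball_mem_nhds x (inv_pos.2 (pow_pos two_pos n)))
    obtain ⟨k, hk, z, hz, hzx⟩ := exists_mem_posCells_inter_nonempty hsupp n hball.ne'
    refine mem_iUnion₂.2 ⟨p k, Finset.mem_coe.2 (Finset.mem_image_of_mem p hk), ?_⟩
    rw [Real.coe_toNNReal _ (le_trans (by positivity) hε), Metric.mem_closedBall]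
    have hzp := abs_sub_le_of_mem_dyadicCell hz (hp k hk).1
    rw [← Real.dist_eq] at hzp
    rw [Metric.mem_ball'] at hzx
    linarith [dist_triangle x z (p k)]
  refine (hcover.coveringNumber_le_encard hsub).trans ?_
  rw [Set.encard_coe_eq_coe_finsetCard]
  exact_mod_cast Finset.card_image_le

theorem mem_Icc_ceil_of_mem_dyadicCell {y c : ℝ} (hy : y ∈ dyadicCell n k)
    (hc : |y - c| ≤ (2 ^ n)⁻¹) : k ∈ Finset.Icc (⌈c * 2 ^ n⌉₊ - 2) ⌈c * 2 ^ n⌉₊ := by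
  have hpow : (0 : ℝ) < 2 ^ n := by positivity
  have hlow : (k : ℝ) < y * 2 ^ n := (div_lt_iff₀ hpow).1 hy.1
  have hupp : y * 2 ^ n ≤ k + 1 := (le_div_iff₀ hpow).1 hy.2
  have hdist : |y * 2 ^ n - c * 2 ^ n| ≤ 1 := by
    rwa [← sub_mul, abs_mul, abs_of_pos hpow, ← le_div_iff₀ hpow, one_div]
  rw [abs_le] at hdist
  rw [Finset.mem_Icc, tsub_le_iff_right, Nat.ceil_le, ← Nat.lt_succ_iff]
  refine ⟨by push_cast; linarith, ?_⟩
  have : (k : ℝ) < ⌈c * 2 ^ n⌉₊ + 1 := by linarith [Nat.le_ceil (c * 2 ^ n)]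
  exact_mod_cast this

theorem card_posCells_le_coveringNumber (ν : Measure ℝ) (n : ℕ) :
    ((posCells ν n).card : ℕ∞) ≤ 3 * Metric.coveringNumber ((2 : ℝ) ^ n)⁻¹.toNNReal ν.support := by
  classical
  by_cases htop : Metric.coveringNumber ((2 : ℝ) ^ n)⁻¹.toNNReal ν.support = ⊤
  · simp [htop]
  obtain ⟨C, -, hfin, hcover, hcard⟩ := Metric.exists_set_encard_eq_coveringNumber htop
  rw [Metric.isCover_iff_subset_iUnion_closedBall] at hcover
  have hsub : posCells ν n ⊆ hfin.toFinset.biUnion fun c =>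
      Finset.Icc (⌈c * 2 ^ n⌉₊ - 2) ⌈c * 2 ^ n⌉₊ := by
    intro k hk
    obtain ⟨y, hyk, hys⟩ := Measure.nonempty_inter_support_of_pos (mem_posCells.1 hk).2
    obtain ⟨c, hc, hyc⟩ := mem_iUnion₂.1 (hcover hys)
    rw [Real.coe_toNNReal _ (by positivity), Metric.mem_closedBall, Real.dist_eq] at hyc
    exact Finset.mem_biUnion.2
      ⟨c, hfin.mem_toFinset.2 hc, mem_Icc_ceil_of_mem_dyadicCell hyk hyc⟩
  have hle : (posCells ν n).card ≤ hfin.toFinset.card * 3 :=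
    (Finset.card_le_card hsub).trans <| Finset.card_biUnion_le_card_mul _ _ _ fun c _ => by
      rw [Nat.card_Icc]
      lia
  rw [← hcard, hfin.encard_eq_coe_toFinset_card, mul_comm]
  exact_mod_cast hle

theorem upperMinkowskiDim_eq (A : Set ℝ) : upperMinkowskiDim A =
    limsup (fun ε : ℝ => ENNReal.log (Metric.coveringNumber ε.toNNReal A : ℝ≥0∞) /
      (Real.log ε⁻¹ : EReal)) (𝓝[>] 0) := by
  simp only [upperMinkowskiDim, Real.log_inv]

theorem exists_two_pow_near_inv (hε : 0 < ε) (hε1 : ε ≤ 1) :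
    ∃ n : ℕ, 2 * ((2 : ℝ) ^ n)⁻¹ ≤ ε ∧ (2 : ℝ) ^ n ≤ 4 * ε⁻¹ := by
  obtain ⟨n, hle, hlt⟩ := exists_nat_pow_near (x := 2 * ε⁻¹) (y := (2 : ℝ))
    (by linarith [(one_le_inv₀ hε).2 hε1]) one_lt_two
  refine ⟨n + 1, ?_, by rw [pow_succ]; linarith⟩
  rw [← div_eq_mul_inv, div_lt_iff₀ hε] at hlt
  rw [← div_eq_mul_inv, div_le_iff₀ (by positivity)]
  linarith

theorem HasGrowth.upperMinkowskiDim_le (hsupp : ν (Ioo (0 : ℝ) 1)ᶜ = 0) {c : ℝ}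
    (h : HasGrowth ν 0 c) (hc : 0 ≤ c) : upperMinkowskiDim ν.support ≤ c := by
  obtain ⟨A, hA, h⟩ := h
  rw [upperMinkowskiDim_eq]
  refine limsup_log_div_log_le (A := A * 4 ^ c) tendsto_inv_nhdsGT_zero ?_
  filter_upwards [Ioo_mem_nhdsGT (zero_lt_one' ℝ)] with ε hε
  obtain ⟨n, hn, hpow⟩ := exists_two_pow_near_inv hε.1 hε.2.le
  have hcard : ((posCells ν n).card : ℝ) ≤ A * 4 ^ c * ε⁻¹ ^ c := by
    calc ((posCells ν n).card : ℝ) ≤ A * (2 : ℝ) ^ ((n : ℝ) * c) := powSum_zero ν n ▸ h n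
      _ = A * ((2 : ℝ) ^ n) ^ c := by rw [Real.rpow_mul zero_le_two, Real.rpow_natCast]
      _ ≤ A * (4 * ε⁻¹) ^ c := by gcongr
      _ = A * 4 ^ c * ε⁻¹ ^ c := by
        rw [Real.mul_rpow (by norm_num) (inv_nonneg.2 hε.1.le), mul_assoc]
  calc (Metric.coveringNumber ε.toNNReal ν.support : ℝ≥0∞)
      ≤ ((posCells ν n).card : ℕ∞) :=
        ENat.toENNReal_le.2 (coveringNumber_le_card_posCells hsupp hn)
    _ ≤ ENNReal.ofReal (A * 4 ^ c * ε⁻¹ ^ c) := by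
        rw [ENat.toENNReal_coe, ← ENNReal.ofReal_natCast]
        exact ENNReal.ofReal_le_ofReal hcard

theorem hasGrowth_zero_of_upperMinkowskiDim_lt {c : ℝ} (h : upperMinkowskiDim ν.support < c) :
    HasGrowth ν 0 c := by
  have hscale : Tendsto (fun n : ℕ => ((2 : ℝ) ^ n)⁻¹) atTop (𝓝[>] 0) :=
    tendsto_inv_atTop_nhdsGT_zero.comp (tendsto_pow_atTop_atTop_of_one_lt one_lt_two)
  rw [upperMinkowskiDim_eq] at h
  refine hasGrowth_of_eventually three_pos ?_
  filter_upwards [hscale.eventually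
    (eventually_le_of_limsup_log_div_log_lt tendsto_inv_nhdsGT_zero h)] with n hn
  rw [inv_inv] at hn
  have hcard : ((posCells ν n).card : ℝ≥0∞) ≤ ENNReal.ofReal (3 * ((2 : ℝ) ^ n) ^ c) := by
    rw [ENNReal.ofReal_mul zero_le_three, ENNReal.ofReal_ofNat]
    refine le_trans ?_ (mul_le_mul_right hn 3)
    exact_mod_cast ENat.toENNReal_le.2 (card_posCells_le_coveringNumber ν n)
  rw [powSum_zero, Real.rpow_mul zero_le_two, Real.rpow_natCast]
  rwa [← ENNReal.ofReal_natCast, ENNReal.ofReal_le_ofReal_iff (by positivity)] at hcard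

theorem upperMinkowskiDim_support [IsFiniteMeasure ν] [NeZero ν]
    (hsupp : ν (Ioo (0 : ℝ) 1)ᶜ = 0) : upperMinkowskiDim ν.support = lqReal ν 0 := by
  refine le_antisymm (EReal.le_of_forall_lt_iff_le.1 fun c hc => ?_)
    (EReal.le_of_forall_lt_iff_le.1 fun c hc => ?_)
  · have hgrowth := hasGrowth_of_lqReal_lt hsupp le_rfl (EReal.coe_lt_coe_iff.1 hc)
    exact hgrowth.upperMinkowskiDim_le hsupp (hgrowth.nonneg_of_le_one hsupp zero_le_one)
  · exact EReal.coe_le_coe_iff.2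
      ((hasGrowth_zero_of_upperMinkowskiDim_lt hc).lqReal_le hsupp le_rfl)

end Covering

/-! ### Heavy cells and the eigenvalue counting function -/

open Classical in
/-- The indices of the dyadic cells of level `n` with measure at least `m`. -/
def heavyCells (ν : Measure ℝ) (n : ℕ) (m : ℝ) : Finset ℕ :=
  (Finset.range (2 ^ n)).filter fun k => m ≤ ν.real (dyadicCell n k)

/-- The eigenvalue counting function as a natural number. It takes the junk value `0` where the
count is infinite, which does not happen for a finite measure on `(0,1)`. -/
def eigenvalueNum (ν : Measure ℝ) (x : ℝ) : ℕ := (eigenvalueCount ν x).toNat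

/-- The trapezoid which is `1` on the cell `(k 2⁻ⁿ, (k+1) 2⁻ⁿ]` and descends to `0` over the two
neighbouring cells. -/
def cellTrapezoid {n k : ℕ} (hk : 1 ≤ k) (hkn : k + 2 ≤ 2 ^ n) : Trapezoid where
  a := (k - 1) / 2 ^ n
  b := k / 2 ^ n
  c := (k + 1) / 2 ^ n
  d := (k + 2) / 2 ^ n
  zero_le := div_nonneg (sub_nonneg.2 (by exact_mod_cast hk)) (by positivity)
  a_lt_b := by gcongr; linarith
  b_le_c := by gcongr; linarith
  c_lt_d := by gcongr; norm_num
  le_one := (div_le_one (by positivity)).2 (by exact_mod_cast hkn)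

theorem disjoint_cellTrapezoid {n j k : ℕ} {hj : 1 ≤ j} {hjn : j + 2 ≤ 2 ^ n} {hk : 1 ≤ k}
    {hkn : k + 2 ≤ 2 ^ n} (hjk : j ≠ k) (hmod : j % 3 = k % 3) :
    Disjoint (Ioo (cellTrapezoid hj hjn).a (cellTrapezoid hj hjn).d)
      (Ioo (cellTrapezoid hk hkn).a (cellTrapezoid hk hkn).d) := by
  wlog hlt : j < k generalizing j k
  · exact (this hjk.symm hmod.symm (by lia)).symm
  refine Ioo_disjoint_Ioo.2 (min_le_of_left_le (le_max_of_le_right ?_))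
  have hgap : (j : ℝ) + 3 ≤ k := by exact_mod_cast (by lia : j + 3 ≤ k)
  exact div_le_div_of_nonneg_right (by linarith) (by positivity)

theorem geom_sum_le_inv_one_sub {r : ℝ} (hr0 : 0 ≤ r) (hr1 : r < 1) (N : ℕ) :
    ∑ j ∈ Finset.range N, r ^ j ≤ (1 - r)⁻¹ :=
  tsum_geometric_of_lt_one hr0 hr1 ▸
    (summable_geometric_of_lt_one hr0 hr1).sum_le_tsum _ fun _ _ => by positivity

section WeakType

variable {ι : Type*} {u : Finset ι} {a : ι → ℝ} {M B q s : ℝ}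

theorem exists_sum_rpow_le_sum_card (hM : 0 < M) (hq : 0 ≤ q) (ha : ∀ i ∈ u, 0 < a i)
    (haM : ∀ i ∈ u, a i ≤ M) : ∃ J : ℕ, ∑ i ∈ u, a i ^ q ≤
      ∑ j ∈ Finset.range J, ((u.filter fun i => M / 2 ^ (j + 1) ≤ a i).card : ℝ) *
        (M / 2 ^ j) ^ q := by
  have hlevel : ∀ i ∈ u, ∃ j : ℕ, M / 2 ^ (j + 1) ≤ a i ∧ a i ≤ M / 2 ^ j := by
    intro i hi
    obtain ⟨j, hle, hlt⟩ := exists_nat_pow_near ((one_le_div (ha i hi)).2 (haM i hi))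
      one_lt_two
    refine ⟨j, (div_le_comm₀ (ha i hi) (by positivity)).1 hlt.le, ?_⟩
    rwa [le_div_comm₀ (ha i hi) (by positivity)]
  choose! level hlevel using hlevel
  refine ⟨u.sup level + 1, ?_⟩
  simp only [← nsmul_eq_mul, ← Finset.sum_const, Finset.sum_filter]
  rw [Finset.sum_comm]
  refine Finset.sum_le_sum fun i hi => ?_
  calc a i ^ q ≤ (M / 2 ^ level i) ^ q :=
        Real.rpow_le_rpow (ha i hi).le (hlevel i hi).2 hq
    _ = if M / 2 ^ (level i + 1) ≤ a i then (M / 2 ^ level i) ^ q else 0 :=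
        (if_pos (hlevel i hi).1).symm
    _ ≤ _ := Finset.single_le_sum
        (f := fun j => if M / 2 ^ (j + 1) ≤ a i then (M / 2 ^ j) ^ q else 0)
        (fun j _ => by positivity) (Finset.mem_range_succ_iff.2 (Finset.le_sup hi))

theorem sum_rpow_le_of_card_le (hM : 0 < M) (hB : 0 ≤ B) (hq : 0 ≤ q) (hsq : s < q)
    (ha : ∀ i ∈ u, 0 < a i) (haM : ∀ i ∈ u, a i ≤ M)
    (h : ∀ m, 0 < m → m ≤ M → ((u.filter fun i => m ≤ a i).card : ℝ) ≤ B * m ^ (-s)) :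
    ∑ i ∈ u, a i ^ q ≤ B * (2 ^ s * M ^ (q - s) * (1 - 2 ^ (s - q))⁻¹) := by
  obtain ⟨J, hJ⟩ := exists_sum_rpow_le_sum_card hM hq ha haM
  have hterm : ∀ j : ℕ, ((u.filter fun i => M / 2 ^ (j + 1) ≤ a i).card : ℝ) * (M / 2 ^ j) ^ q ≤
      B * (2 ^ s * M ^ (q - s)) * (2 ^ (s - q)) ^ j := by
    intro j
    have hMj : 0 < M / 2 ^ j := by positivity
    calc _ ≤ B * (M / 2 ^ (j + 1)) ^ (-s) * (M / 2 ^ j) ^ q := by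
          gcongr
          exact h _ (by positivity) (div_le_self hM.le (one_le_pow₀ one_le_two))
      _ = B * (2 ^ s * (M / 2 ^ j) ^ (q - s)) := by
          rw [pow_succ, ← div_div, Real.div_rpow hMj.le zero_le_two, Real.rpow_neg zero_le_two,
            div_inv_eq_mul, sub_eq_neg_add, Real.rpow_add hMj]
          ring
      _ = B * (2 ^ s * M ^ (q - s)) * (2 ^ (s - q)) ^ j := by
          rw [Real.div_rpow hM.le (by positivity), ← Real.rpow_pow_comm zero_le_two,
            ← neg_sub q s, Real.rpow_neg zero_le_two, inv_pow]
          ring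
  calc ∑ i ∈ u, a i ^ q ≤ ∑ j ∈ Finset.range J, B * (2 ^ s * M ^ (q - s)) * (2 ^ (s - q)) ^ j :=
        hJ.trans (Finset.sum_le_sum fun j _ => hterm j)
    _ = B * (2 ^ s * M ^ (q - s)) * ∑ j ∈ Finset.range J, ((2 : ℝ) ^ (s - q)) ^ j := by
        rw [Finset.mul_sum]
    _ ≤ B * (2 ^ s * M ^ (q - s)) * (1 - 2 ^ (s - q))⁻¹ := by
        gcongr
        exact geom_sum_le_inv_one_sub (by positivity)
          (Real.rpow_lt_one_of_one_lt_of_neg one_lt_two (sub_neg.2 hsq)) J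
    _ = _ := by ring

end WeakType

section HeavyCells

variable {ν : Measure ℝ} {n k : ℕ} {m q c : ℝ}

theorem mem_heavyCells : k ∈ heavyCells ν n m ↔ k < 2 ^ n ∧ m ≤ ν.real (dyadicCell n k) := by
  simp [heavyCells]

theorem heavyCells_subset_posCells (hm : 0 < m) : heavyCells ν n m ⊆ posCells ν n := by
  intro k hk
  rw [mem_heavyCells] at hk
  exact mem_posCells.2 ⟨hk.1, (ENNReal.toReal_pos_iff.1 (hm.trans_le hk.2)).1⟩

theorem card_heavyCells_mul_rpow_le (hm : 0 < m) (hq : 0 ≤ q) :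
    (heavyCells ν n m).card * m ^ q ≤ powSum ν n q := by
  rw [← nsmul_eq_mul]
  refine (Finset.card_nsmul_le_sum _ _ _ fun k hk => Real.rpow_le_rpow hm.le
    (mem_heavyCells.1 hk).2 hq).trans (Finset.sum_le_sum_of_subset_of_nonneg
      (heavyCells_subset_posCells hm) fun _ _ _ => Real.rpow_nonneg measureReal_nonneg _)

theorem HasGrowth.exists_sum_card_heavyCells_le (h : HasGrowth ν q c) (hq : 0 ≤ q) (hcq : c < q) :
    ∃ B, ∀ t > 0, ∀ N : ℕ,
      ∑ n ∈ Finset.range N, ((heavyCells ν n (t * 2 ^ n)).card : ℝ) ≤ B * t⁻¹ ^ q := by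
  obtain ⟨A, hA, h⟩ := h
  set r : ℝ := 2 ^ (c - q) with hr
  have hr1 : r < 1 := Real.rpow_lt_one_of_one_lt_of_neg one_lt_two (by linarith)
  refine ⟨A * (1 - r)⁻¹, fun t ht N => ?_⟩
  have hterm : ∀ n : ℕ, ((heavyCells ν n (t * 2 ^ n)).card : ℝ) ≤ A * t⁻¹ ^ q * r ^ n := by
    intro n
    have hr_pow : r ^ n = 2 ^ ((n : ℝ) * c) / ((2 : ℝ) ^ n) ^ q := by
      rw [hr, ← Real.rpow_natCast, ← Real.rpow_mul zero_le_two, ← Real.rpow_natCast 2 n,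
        ← Real.rpow_mul zero_le_two, ← Real.rpow_sub two_pos]
      ring_nf
    have hcard := (card_heavyCells_mul_rpow_le (m := t * 2 ^ n) (by positivity) hq).trans (h n)
    rw [Real.mul_rpow ht.le (by positivity), ← le_div_iff₀ (by positivity)] at hcard
    refine hcard.trans_eq ?_
    rw [hr_pow, Real.inv_rpow ht.le]
    field_simp
  calc ∑ n ∈ Finset.range N, ((heavyCells ν n (t * 2 ^ n)).card : ℝ)
      ≤ ∑ n ∈ Finset.range N, A * t⁻¹ ^ q * r ^ n := Finset.sum_le_sum fun n _ => hterm n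
    _ = A * t⁻¹ ^ q * ∑ n ∈ Finset.range N, r ^ n := by rw [Finset.mul_sum]
    _ ≤ A * t⁻¹ ^ q * (1 - r)⁻¹ := by
        gcongr
        exact geom_sum_le_inv_one_sub (by positivity) hr1 N
    _ = A * (1 - r)⁻¹ * t⁻¹ ^ q := by ring

end HeavyCells

section EigenvalueNum

variable {ν : Measure ℝ} [IsFiniteMeasure ν] {n r : ℕ} {m x t q c s : ℝ}
  (hsupp : ν (Ioo (0 : ℝ) 1)ᶜ = 0)
include hsupp

theorem exists_eigenvalueCount_le_sum_card (ht : 0 < t) (hxt : x * t < 1) :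
    ∃ N : ℕ, eigenvalueCount ν x ≤
      ((∑ n ∈ Finset.range N, (heavyCells ν n (t * 2 ^ n)).card : ℕ) : ℕ∞) := by
  obtain ⟨N, hN⟩ := pow_unbounded_of_one_lt (ν.real univ / t) (one_lt_two (α := ℝ))
  rw [div_lt_iff₀' ht] at hN
  refine ⟨N, (eigenvalueCount_le_card hsupp ht hxt ((Finset.range N).biUnion fun n =>
    (heavyCells ν n (t * 2 ^ n)).image fun k => (n, k)) fun n k hk h => ?_).trans ?_⟩
  · refine Finset.mem_biUnion.2 ⟨n, Finset.mem_range.2 ?_, Finset.mem_image.2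
      ⟨k, mem_heavyCells.2 ⟨hk, h.le⟩, rfl⟩⟩
    by_contra! hNn
    refine (h.trans_le (measureReal_mono (subset_univ _))).not_ge (hN.le.trans ?_)
    gcongr
    exact one_le_two
  · exact_mod_cast Finset.card_biUnion_le.trans
      (Finset.sum_le_sum fun n _ => Finset.card_image_le)

theorem coe_eigenvalueNum (x : ℝ) : (eigenvalueNum ν x : ℕ∞) = eigenvalueCount ν x := by
  have hxt : x * (|x| + 1)⁻¹ < 1 := by
    rw [← div_eq_mul_inv, div_lt_one (by positivity)]
    linarith [le_abs_self x]
  obtain ⟨N, hN⟩ := exists_eigenvalueCount_le_sum_card hsupp (by positivity) hxt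
  exact ENat.natCast_toNat (ne_top_of_le_ne_top (ENat.natCast_ne_top _) hN)

theorem HasGrowth.exists_eigenvalueNum_le (h : HasGrowth ν q c) (hq : 0 ≤ q) (hcq : c < q) :
    ∃ B, ∀ x > 0, (eigenvalueNum ν x : ℝ) ≤ B * x ^ q := by
  obtain ⟨B, hB⟩ := h.exists_sum_card_heavyCells_le hq hcq
  refine ⟨B * 2 ^ q, fun x hx => ?_⟩
  have hxt : x * (2 * x)⁻¹ < 1 := by
    rw [← div_eq_mul_inv, div_lt_one (by positivity)]
    linarith
  obtain ⟨N, hN⟩ := exists_eigenvalueCount_le_sum_card hsupp (by positivity) hxt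
  rw [← coe_eigenvalueNum hsupp] at hN
  calc (eigenvalueNum ν x : ℝ)
      ≤ ∑ n ∈ Finset.range N, ((heavyCells ν n ((2 * x)⁻¹ * 2 ^ n)).card : ℝ) := by
        exact_mod_cast hN
    _ ≤ B * (2 * x)⁻¹⁻¹ ^ q := hB _ (by positivity) N
    _ = B * 2 ^ q * x ^ q := by rw [inv_inv, Real.mul_rpow zero_le_two hx.le, mul_assoc]

theorem card_filter_heavyCells_le (hx : 0 < x) (h : 2 * 2 ^ n < x * m) (r : ℕ) :
    ((heavyCells ν n m).filter fun k => 1 ≤ k ∧ k + 2 ≤ 2 ^ n ∧ k % 3 = r).card ≤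
      eigenvalueNum ν x := by
  set F := (heavyCells ν n m).filter fun k => 1 ≤ k ∧ k + 2 ≤ 2 ^ n ∧ k % 3 = r
  have hF : ∀ i : F, m ≤ ν.real (dyadicCell n i) ∧
      1 ≤ (i : ℕ) ∧ (i : ℕ) + 2 ≤ 2 ^ n ∧ (i : ℕ) % 3 = r := fun i =>
    (Finset.mem_filter.1 i.2).imp_left fun hi => (mem_heavyCells.1 hi).2
  have hcount := card_le_eigenvalueCount (ν := ν) (x := x)
    (p := fun i : F => cellTrapezoid (hF i).2.1 (hF i).2.2.1)
    (fun i j hij => disjoint_cellTrapezoid (fun h => hij (Subtype.ext h))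
      ((hF i).2.2.2.trans (hF j).2.2.2.symm)) hx fun i => ?_
  · rw [← coe_eigenvalueNum hsupp, Fintype.card_coe] at hcount
    exact_mod_cast hcount
  · have hslope : ((i : ℝ) / 2 ^ n - (i - 1) / 2 ^ n)⁻¹ +
        (((i : ℝ) + 2) / 2 ^ n - (i + 1) / 2 ^ n)⁻¹ = 2 * 2 ^ n := by
      rw [← sub_div, ← sub_div, sub_sub_cancel, add_sub_add_left_eq_sub]
      norm_num
      ring
    refine (hslope.trans_lt h).trans_le (mul_le_mul_of_nonneg_left ?_ hx.le)
    exact (hF i).1.trans (measureReal_mono Ioc_subset_Icc_self)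

theorem card_heavyCells_le (hx : 0 < x) (h : 2 * 2 ^ n < x * m) :
    (heavyCells ν n m).card ≤ 3 * eigenvalueNum ν x + 2 := by
  let F : ℕ → Finset ℕ := fun r =>
    (heavyCells ν n m).filter fun k => 1 ≤ k ∧ k + 2 ≤ 2 ^ n ∧ k % 3 = r
  have hcover : heavyCells ν n m ⊆ (Finset.range 3).biUnion F ∪ {0, 2 ^ n - 1} := by
    intro k hk
    have hkn := (mem_heavyCells.1 hk).1
    simp only [F, Finset.mem_union, Finset.mem_biUnion, Finset.mem_range, Finset.mem_filter, hk,
      true_and, Finset.mem_insert, Finset.mem_singleton]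
    by_cases hend : k = 0 ∨ k = 2 ^ n - 1
    · exact Or.inr hend
    · exact Or.inl ⟨k % 3, Nat.mod_lt _ three_pos, by lia, by lia, rfl⟩
  calc (heavyCells ν n m).card ≤ ((Finset.range 3).biUnion F).card + 2 :=
        (Finset.card_le_card hcover).trans
          ((Finset.card_union_le _ _).trans (Nat.add_le_add_left Finset.card_le_two _))
    _ ≤ 3 * eigenvalueNum ν x + 2 := by
        refine Nat.add_le_add_right ?_ 2
        simpa using Finset.card_biUnion_le_card_mul (Finset.range 3) F _ fun r _ =>
          card_filter_heavyCells_le hsupp hx h r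

variable [NeZero ν]

theorem exists_measureReal_Icc_pos :
    ∃ δ : ℝ, 0 < δ ∧ δ ≤ 1 - δ ∧ 0 < ν.real (Icc δ (1 - δ)) := by
  have hexhaust : Ioo (0 : ℝ) 1 ⊆ ⋃ n : ℕ, Icc (1 / ((n : ℝ) + 1)) (1 - 1 / ((n : ℝ) + 1)) := by
    intro y hy
    obtain ⟨n, hn⟩ := exists_nat_one_div_lt (lt_min hy.1 (sub_pos.2 hy.2))
    rw [lt_min_iff] at hn
    exact mem_iUnion.2 ⟨n, hn.1.le, by linarith⟩
  have hpos : ν (⋃ n : ℕ, Icc (1 / ((n : ℝ) + 1)) (1 - 1 / ((n : ℝ) + 1))) ≠ 0 := fun h =>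
    NeZero.ne (ν univ) (union_compl_self (Ioo (0 : ℝ) 1) ▸
      measure_union_null (measure_mono_null hexhaust h) hsupp)
  obtain ⟨n, hn⟩ := exists_measure_pos_of_not_measure_iUnion_null hpos
  obtain ⟨y, hy⟩ := nonempty_of_measure_ne_zero hn.ne'
  exact ⟨_, by positivity, hy.1.trans hy.2, ENNReal.toReal_pos hn.ne' (measure_ne_top _ _)⟩

theorem eventually_one_le_eigenvalueNum : ∀ᶠ x in atTop, 1 ≤ eigenvalueNum ν x := by
  obtain ⟨δ, hδ, hδ1, hpos⟩ := exists_measureReal_Icc_pos hsupp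
  let plateau : Trapezoid := ⟨0, δ, 1 - δ, 1, le_rfl, hδ, hδ1, by linarith, le_rfl⟩
  filter_upwards [eventually_gt_atTop 0, (tendsto_id.atTop_mul_const hpos).eventually_gt_atTop
    ((δ - 0)⁻¹ + (1 - (1 - δ))⁻¹)] with x hx hlt
  have hcount := card_le_eigenvalueCount (p := fun _ : Unit => plateau)
    (fun i j hij => absurd (Subsingleton.elim i j) hij) hx fun _ => hlt
  rw [← coe_eigenvalueNum hsupp] at hcount
  simpa using hcount

theorem exists_card_heavyCells_le_mul_rpow (hs : 0 ≤ s)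
    (h : ∀ᶠ x in atTop, (eigenvalueNum ν x : ℝ) ≤ x ^ s) :
    ∃ B > 0, ∀ (n : ℕ) (m : ℝ), 0 < m → m ≤ ν.real univ →
      ((heavyCells ν n m).card : ℝ) ≤ B * (2 : ℝ) ^ ((n : ℝ) * s) * m ^ (-s) := by
  set M := ν.real univ
  have hM : 0 < M := measureReal_univ_pos
  obtain ⟨x₁, h⟩ := eventually_atTop.1 h
  set K : ℝ := max (x₁ * M) 3
  have hK : 3 ≤ K := le_max_right _ _
  refine ⟨3 * K ^ s + 2 * M ^ s, by positivity, fun n m hm hmM => ?_⟩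
  have hpow : (1 : ℝ) ≤ 2 ^ n := one_le_pow₀ one_le_two
  have hone : 1 ≤ M ^ s * (2 : ℝ) ^ ((n : ℝ) * s) * m ^ (-s) := by
    rw [mul_right_comm, Real.rpow_neg hm.le, ← div_eq_mul_inv, ← Real.div_rpow hM.le hm.le]
    exact one_le_mul_of_one_le_of_one_le (Real.one_le_rpow ((one_le_div hm).2 hmM) hs)
      (Real.one_le_rpow one_le_two (by positivity))
  have hx₁ : x₁ ≤ K * 2 ^ n / m :=
    calc x₁ ≤ K * 1 / M := by rw [mul_one, le_div_iff₀ hM]; exact le_max_left _ _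
      _ ≤ K * 2 ^ n / m := by gcongr
  have hx_rpow : (K * 2 ^ n / m) ^ s = K ^ s * ((2 : ℝ) ^ ((n : ℝ) * s) * m ^ (-s)) := by
    rw [mul_div_assoc, Real.mul_rpow (by positivity) (by positivity),
      Real.div_rpow (by positivity) hm.le, Real.rpow_mul zero_le_two, Real.rpow_natCast,
      Real.rpow_neg hm.le, div_eq_mul_inv]
  have hlarge : 2 * (2 : ℝ) ^ n < K * 2 ^ n / m * m := by
    rw [div_mul_cancel₀ _ hm.ne']
    nlinarith
  calc ((heavyCells ν n m).card : ℝ) ≤ 3 * eigenvalueNum ν (K * 2 ^ n / m) + 2 := by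
        exact_mod_cast card_heavyCells_le hsupp (by positivity) hlarge
    _ ≤ 3 * (K ^ s * ((2 : ℝ) ^ ((n : ℝ) * s) * m ^ (-s))) +
          2 * (M ^ s * (2 : ℝ) ^ ((n : ℝ) * s) * m ^ (-s)) := by
        linarith [hx_rpow ▸ h _ hx₁]
    _ = (3 * K ^ s + 2 * M ^ s) * (2 : ℝ) ^ ((n : ℝ) * s) * m ^ (-s) := by ring

theorem hasGrowth_of_eigenvalueNum_le (hs : 0 ≤ s) (hsq : s < q)
    (h : ∀ᶠ x in atTop, (eigenvalueNum ν x : ℝ) ≤ x ^ s) : HasGrowth ν q s := by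
  obtain ⟨B, hB, hcard⟩ := exists_card_heavyCells_le_mul_rpow hsupp hs h
  have hM : 0 < ν.real univ := measureReal_univ_pos
  have hr : 0 < 1 - (2 : ℝ) ^ (s - q) :=
    sub_pos.2 (Real.rpow_lt_one_of_one_lt_of_neg one_lt_two (sub_neg.2 hsq))
  refine ⟨B * (2 ^ s * ν.real univ ^ (q - s) * (1 - 2 ^ (s - q))⁻¹), by positivity, fun n => ?_⟩
  refine (sum_rpow_le_of_card_le hM (by positivity) (hs.trans hsq.le) hsq
    (fun _ => measureReal_pos_of_mem_posCells) (fun _ _ => measureReal_mono (subset_univ _))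
    fun m hm hmM => le_trans ?_ (hcard n m hm hmM)).trans_eq (by ring)
  refine Nat.cast_le.2 (Finset.card_le_card fun k hk => ?_)
  rw [Finset.mem_filter] at hk
  exact mem_heavyCells.2 ⟨(mem_posCells.1 hk.1).1, hk.2⟩

end EigenvalueNum

section SpectralDim

theorem exists_eventually_mul_rpow_le {F : ℝ → ℝ} {g A K s : ℝ} (hg : 1 < g) (hA : 0 < A)
    (hK : 0 < K) (hs : 0 ≤ s)
    (h : ∀ᶠ n : ℕ in atTop, ∀ x, A * g ^ n ≤ x → K * (g ^ n) ^ s ≤ F x) :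
    ∃ K' > 0, ∀ᶠ x in atTop, K' * x ^ s ≤ F x := by
  have : 0 < g := one_pos.trans hg
  obtain ⟨N, h⟩ := eventually_atTop.1 h
  refine ⟨K * (A * g)⁻¹ ^ s, by positivity, ?_⟩
  filter_upwards [eventually_ge_atTop (A * g ^ N)] with x hx
  have hx' : g ^ N ≤ x / A := (le_div_iff₀' hA).2 hx
  have hx0 : 0 < x := (by positivity : 0 < A * g ^ N).trans_le hx
  obtain ⟨n, hn, hn'⟩ := exists_nat_pow_near ((one_le_pow₀ hg.le).trans hx') hg
  have hNn : N ≤ n := Nat.lt_succ_iff.1 ((pow_lt_pow_iff_right₀ hg).1 (hx'.trans_lt hn'))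
  have hxg : (A * g)⁻¹ * x ≤ g ^ n := by
    rw [inv_mul_le_iff₀ (by positivity), mul_assoc, ← pow_succ', ← div_le_iff₀' hA]
    exact hn'.le
  calc K * (A * g)⁻¹ ^ s * x ^ s = K * ((A * g)⁻¹ * x) ^ s := by
        rw [mul_assoc, Real.mul_rpow (by positivity) hx0.le]
    _ ≤ K * (g ^ n) ^ s := by gcongr
    _ ≤ F x := h n hNn x ((le_div_iff₀' hA).1 hn)

theorem le_ite_add_rpow_mul_rpow {m u v t t' : ℝ} (hm : 0 < m) (hu : 0 ≤ u) (hv : 0 < v)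
    (ht : t ≤ 1) (ht' : 1 ≤ t') :
    m ≤ (if u ≤ m then v else 0) + m ^ t * u ^ (1 - t) + m ^ t' * v ^ (1 - t') := by
  have hsplit (r : ℝ) : m = m ^ r * m ^ (1 - r) := by
    rw [← Real.rpow_add hm, add_sub_cancel, Real.rpow_one]
  have hlight : 0 ≤ m ^ t * u ^ (1 - t) := by positivity
  have hheavy : 0 ≤ m ^ t' * v ^ (1 - t') := by positivity
  rcases lt_or_ge m u with hmu | hum
  · have : m ≤ m ^ t * u ^ (1 - t) :=
      (hsplit t).trans_le (by gcongr)
    rw [if_neg hmu.not_ge]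
    linarith
  · rw [if_pos hum]
    rcases le_or_gt m v with hmv | hvm
    · linarith
    · have : m ≤ m ^ t' * v ^ (1 - t') := (hsplit t').trans_le <| by
        gcongr ?_ * ?_
        exact Real.rpow_le_rpow_of_nonpos hv hvm.le (sub_nonpos.2 ht')
      linarith

variable {ν : Measure ℝ} {a b c t q s K : ℝ}

theorem HasGrowth.tendsto_powSum_mul_rpow (h : HasGrowth ν t c) (hc : c < a * (1 - t)) :
    Tendsto (fun n : ℕ => powSum ν n t * ((2 : ℝ) ^ (-((n : ℝ) * a))) ^ (1 - t)) atTop (𝓝 0) := by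
  obtain ⟨A, -, hA⟩ := h
  refine squeeze_zero (fun n => mul_nonneg (powSum_nonneg ν n t) (by positivity)) (fun n => ?_)
    (tendsto_mul_two_rpow_of_neg A (sub_neg.2 hc))
  calc powSum ν n t * ((2 : ℝ) ^ (-((n : ℝ) * a))) ^ (1 - t)
      ≤ A * 2 ^ ((n : ℝ) * c) * ((2 : ℝ) ^ (-((n : ℝ) * a))) ^ (1 - t) := by
        gcongr
        exact hA n
    _ = A * 2 ^ ((n : ℝ) * (c - a * (1 - t))) := by
        rw [← Real.rpow_mul zero_le_two, mul_assoc, ← Real.rpow_add two_pos]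
        ring_nf

variable [IsFiniteMeasure ν] (hsupp : ν (Ioo (0 : ℝ) 1)ᶜ = 0)
include hsupp

theorem measureReal_univ_le_card_heavyCells_mul {u v t' : ℝ} (n : ℕ) (hu : 0 ≤ u) (hv : 0 < v)
    (ht : t ≤ 1) (ht' : 1 ≤ t') :
    ν.real univ ≤ (heavyCells ν n u).card * v + powSum ν n t * u ^ (1 - t) +
      powSum ν n t' * v ^ (1 - t') := by
  calc ν.real univ = ∑ k ∈ posCells ν n, ν.real (dyadicCell n k) := by
        simp only [← powSum_one hsupp n, powSum, Real.rpow_one]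
    _ ≤ ∑ k ∈ posCells ν n, ((if u ≤ ν.real (dyadicCell n k) then v else 0) +
          ν.real (dyadicCell n k) ^ t * u ^ (1 - t) +
          ν.real (dyadicCell n k) ^ t' * v ^ (1 - t')) :=
        Finset.sum_le_sum fun k hk =>
          le_ite_add_rpow_mul_rpow (measureReal_pos_of_mem_posCells hk) hu hv ht ht'
    _ = ((posCells ν n).filter fun k => u ≤ ν.real (dyadicCell n k)).card * v +
          powSum ν n t * u ^ (1 - t) + powSum ν n t' * v ^ (1 - t') := by
        rw [Finset.sum_add_distrib, Finset.sum_add_distrib, ← Finset.sum_mul, ← Finset.sum_mul,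
          ← Finset.sum_filter, Finset.sum_const, nsmul_eq_mul, powSum, powSum]
    _ ≤ _ := by
        gcongr
        intro k hk
        rw [Finset.mem_filter] at hk
        exact mem_heavyCells.2 ⟨(mem_posCells.1 hk.1).1, hk.2⟩

theorem HasGrowth.upperSpectralDim_le (hq : 0 ≤ q) (hcq : c < q) (h : HasGrowth ν q c) :
    upperSpectralDim ν ≤ (q : EReal) := by
  obtain ⟨B, hB⟩ := h.exists_eigenvalueNum_le hsupp hq hcq
  refine limsup_log_div_log_le (A := B) tendsto_id ?_
  filter_upwards [eventually_gt_atTop 0] with x hx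
  rw [← coe_eigenvalueNum hsupp, ENat.toENNReal_coe, ← ENNReal.ofReal_natCast]
  exact ENNReal.ofReal_le_ofReal (hB x hx)

theorem eventually_eigenvalueNum_le_rpow (h : upperSpectralDim ν < (s : EReal)) :
    ∀ᶠ x in atTop, (eigenvalueNum ν x : ℝ) ≤ x ^ s := by
  filter_upwards [eventually_le_of_limsup_log_div_log_lt tendsto_id h, eventually_ge_atTop 0]
    with x hx hx0
  rwa [← coe_eigenvalueNum hsupp, ENat.toENNReal_coe, ← ENNReal.ofReal_natCast, id,
    ENNReal.ofReal_le_ofReal_iff (by positivity)] at hx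

theorem le_lowerSpectralDim (hK : 0 < K)
    (h : ∀ᶠ x in atTop, K * x ^ s ≤ (eigenvalueNum ν x : ℝ)) :
    (s : EReal) ≤ lowerSpectralDim ν := by
  refine le_liminf_log_div_log hK tendsto_id ?_
  filter_upwards [h] with x hx
  rw [← coe_eigenvalueNum hsupp, ENat.toENNReal_coe, ← ENNReal.ofReal_natCast]
  exact ENNReal.ofReal_le_ofReal hx

variable [NeZero ν]

theorem lowerSpectralDim_nonneg : 0 ≤ lowerSpectralDim ν := by
  refine le_lowerSpectralDim hsupp (s := 0) one_pos ?_
  filter_upwards [eventually_one_le_eigenvalueNum hsupp] with x hx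
  rw [Real.rpow_zero, one_mul]
  exact_mod_cast hx

theorem upperSpectralDim_nonneg : 0 ≤ upperSpectralDim ν :=
  (lowerSpectralDim_nonneg hsupp).trans liminf_le_limsup

variable {t' c' : ℝ} (ht : t < 1) (h : HasGrowth ν t c) (hc : c < a * (1 - t)) (ht' : 1 < t')
  (h' : HasGrowth ν t' c') (hc' : c' < b * (1 - t'))
include ht h hc ht' h' hc'

/-- Cells lighter than `2^(-na)` and cells heavier than `2^(-nb)` carry a vanishing share of the
mass, so at least about `2^(nb)` cells are needed for the rest. -/
theorem eventually_le_card_heavyCells :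
    ∀ᶠ n : ℕ in atTop, ν.real univ / 2 * (2 : ℝ) ^ ((n : ℝ) * b) ≤
      (heavyCells ν n ((2 : ℝ) ^ (-((n : ℝ) * a)))).card := by
  have hrest := (h.tendsto_powSum_mul_rpow hc).add (h'.tendsto_powSum_mul_rpow hc')
  rw [add_zero] at hrest
  filter_upwards [hrest.eventually_lt_const (half_pos (measureReal_univ_pos (μ := ν)))] with n hn
  have hmass := measureReal_univ_le_card_heavyCells_mul hsupp n
    (u := (2 : ℝ) ^ (-((n : ℝ) * a))) (v := (2 : ℝ) ^ (-((n : ℝ) * b)))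
    (by positivity) (by positivity) ht.le ht'.le
  rw [← le_div_iff₀ (by positivity), div_eq_mul_inv _ ((2 : ℝ) ^ _), ← Real.rpow_neg zero_le_two]
  linarith

theorem div_le_lowerSpectralDim (ha : 0 ≤ a) (hb : 0 ≤ b) :
    ((b / (1 + a) : ℝ) : EReal) ≤ lowerSpectralDim ν := by
  have hM : 0 < ν.real univ := measureReal_univ_pos
  have hcount : ∀ᶠ n : ℕ in atTop, ∀ x, 3 * ((2 : ℝ) ^ (1 + a)) ^ n ≤ x →
      ν.real univ / 2 * (((2 : ℝ) ^ (1 + a)) ^ n) ^ (b / (1 + a)) ≤ 3 * eigenvalueNum ν x + 2 := by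
    filter_upwards [eventually_le_card_heavyCells hsupp ht h hc ht' h' hc'] with n hn x hx
    have hpow : ((2 : ℝ) ^ (1 + a)) ^ n = 2 ^ n * (2 : ℝ) ^ ((n : ℝ) * a) := by
      rw [← Real.rpow_natCast, ← Real.rpow_mul zero_le_two, ← Real.rpow_natCast 2 n,
        ← Real.rpow_add two_pos]
      ring_nf
    have hpow_rpow : (((2 : ℝ) ^ (1 + a)) ^ n) ^ (b / (1 + a)) = (2 : ℝ) ^ ((n : ℝ) * b) := by
      rw [← Real.rpow_natCast, ← Real.rpow_mul zero_le_two, ← Real.rpow_mul zero_le_two]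
      field_simp
    have hlarge : 2 * (2 : ℝ) ^ n < x * 2 ^ (-((n : ℝ) * a)) := by
      rw [Real.rpow_neg zero_le_two, ← div_eq_mul_inv, lt_div_iff₀ (by positivity), mul_assoc,
        ← hpow]
      linarith [(by positivity : 0 < ((2 : ℝ) ^ (1 + a)) ^ n)]
    have hx0 : 0 < x := (by positivity : 0 < 3 * ((2 : ℝ) ^ (1 + a)) ^ n).trans_le hx
    rw [hpow_rpow]
    exact hn.trans (by exact_mod_cast card_heavyCells_le hsupp hx0 hlarge)
  obtain ⟨K, hK, hlower⟩ := exists_eventually_mul_rpow_le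
    (Real.one_lt_rpow one_lt_two (by linarith)) three_pos (half_pos hM) (by positivity) hcount
  refine le_lowerSpectralDim hsupp (K := K / 5) (by positivity) ?_
  filter_upwards [hlower, eventually_one_le_eigenvalueNum hsupp] with x hx hone
  have : (1 : ℝ) ≤ eigenvalueNum ν x := by exact_mod_cast hone
  linarith

end SpectralDim

/-! ### Convexity of the `L^q`-spectrum -/

section OneSidedSlopes

theorem exists_eq_coe_of_nonneg_of_le_coe {x : EReal} {r : ℝ} (h0 : 0 ≤ x) (h : x ≤ r) :
    ∃ y : ℝ, x = y :=
  ⟨x.toReal, (EReal.coe_toReal (ne_top_of_le_ne_top (EReal.coe_ne_top r) h)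
    (ne_bot_of_le_ne_bot EReal.zero_ne_bot h0)).symm⟩

variable {ν : Measure ℝ} [IsFiniteMeasure ν] [NeZero ν] {d d' p q s t u v : ℝ}
  (hsupp : ν (Ioo (0 : ℝ) 1)ᶜ = 0)
include hsupp

theorem lqReal_nonneg (h0 : 0 ≤ q) (h1 : q ≤ 1) : 0 ≤ lqReal ν q :=
  le_lqReal hsupp h0 fun _ h => h.nonneg_of_le_one hsupp h1

theorem lqReal_nonpos (h1 : 1 ≤ q) : lqReal ν q ≤ 0 :=
  (hasGrowth_of_one_le hsupp h1).lqReal_le hsupp (zero_le_one.trans h1)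

theorem lqReal_div_nonneg (ht : 0 ≤ t) : 0 ≤ lqReal ν t / (1 - t) := by
  rcases le_total t 1 with h1 | h1
  · exact div_nonneg (lqReal_nonneg hsupp ht h1) (sub_nonneg.2 h1)
  · exact div_nonneg_of_nonpos (lqReal_nonpos hsupp h1) (sub_nonpos.2 h1)

theorem lqReal_div_antitone (hu : 0 ≤ u) (hu1 : u ≠ 1) (hv1 : v ≠ 1) (huv : u ≤ v) :
    lqReal ν v / (1 - v) ≤ lqReal ν u / (1 - u) := by
  have hsecant := (convexOn_lqReal hsupp).secant_mono (a := 1) (mem_Ici.2 zero_le_one)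
    (mem_Ici.2 hu) (mem_Ici.2 (hu.trans huv)) hu1 hv1 huv
  rw [lqReal_one hsupp, sub_zero, sub_zero] at hsecant
  rw [← neg_sub v, ← neg_sub u, div_neg, div_neg]
  exact neg_le_neg hsecant

theorem exists_tendsto_lqReal_div_left :
    ∃ d, Tendsto (fun t => lqReal ν t / (1 - t)) (𝓝[<] 1) (𝓝 d) :=
  ⟨_, AntitoneOn.tendsto_nhdsWithin_Ioo_left (nonempty_Ioo.2 one_pos)
    (fun _ hu _ hv huv => lqReal_div_antitone hsupp hu.1.le hu.2.ne hv.2.ne huv)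
    ⟨0, forall_mem_image.2 fun _ ht => lqReal_div_nonneg hsupp ht.1.le⟩⟩

theorem exists_tendsto_lqReal_div_right :
    ∃ d, Tendsto (fun t => lqReal ν t / (1 - t)) (𝓝[>] 1) (𝓝 d) :=
  ⟨_, AntitoneOn.tendsto_nhdsWithin_Ioo_right (nonempty_Ioo.2 one_lt_two)
    (fun _ hu _ hv huv =>
      lqReal_div_antitone hsupp (one_pos.trans hu.1).le hu.1.ne' hv.1.ne' huv)
    ⟨lqReal ν 0 / (1 - 0), forall_mem_image.2 fun _ ht =>
      lqReal_div_antitone hsupp le_rfl zero_ne_one ht.1.ne' (one_pos.trans ht.1).le⟩⟩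

theorem tendsto_lqSpectrum_div {S : Set ℝ}
    (h : Tendsto (fun t => lqReal ν t / (1 - t)) (𝓝[S] 1) (𝓝 d)) :
    Tendsto (fun t : ℝ => lqSpectrum ν t / ((1 - t : ℝ) : EReal)) (𝓝[S] 1) (𝓝 (d : EReal)) := by
  refine (continuous_coe_real_ereal.continuousAt.tendsto.comp h).congr' ?_
  filter_upwards [mem_nhdsWithin_of_mem_nhds (Ici_mem_nhds one_pos)] with t ht
  rw [Function.comp_apply, EReal.coe_div, coe_lqReal hsupp ht]

theorem nonneg_of_tendsto_lqReal_div {S : Set ℝ} [(𝓝[S] (1 : ℝ)).NeBot]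
    (h : Tendsto (fun t => lqReal ν t / (1 - t)) (𝓝[S] 1) (𝓝 d)) : 0 ≤ d := by
  refine ge_of_tendsto h ?_
  filter_upwards [mem_nhdsWithin_of_mem_nhds (Ici_mem_nhds one_pos)] with t ht
  exact lqReal_div_nonneg hsupp ht

theorem lqReal_le_chord (h0 : 0 ≤ q) (h1 : q ≤ 1) : lqReal ν q ≤ lqReal ν 0 * (1 - q) := by
  have hconv := (convexOn_lqReal hsupp).2 (mem_Ici.2 le_rfl) (mem_Ici.2 zero_le_one)
    (sub_nonneg.2 h1) h0 (sub_add_cancel 1 q)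
  simp only [smul_eq_mul, mul_zero, mul_one, zero_add, lqReal_one hsupp, add_zero] at hconv
  rwa [mul_comm] at hconv

theorem lqReal_lt_chord (hp : p ∈ Ioo (0 : ℝ) 1) (ht : t ∈ Ioo (0 : ℝ) 1)
    (h : lqReal ν t < lqReal ν 0 * (1 - t)) : lqReal ν p < lqReal ν 0 * (1 - p) := by
  rcases le_total t p with htp | hpt
  · rw [← div_lt_iff₀ (sub_pos.2 ht.2)] at h
    rw [← div_lt_iff₀ (sub_pos.2 hp.2)]
    exact (lqReal_div_antitone hsupp ht.1.le ht.2.ne hp.2.ne htp).trans_lt h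
  · have hsecant := (convexOn_lqReal hsupp).secant_mono (a := 0) (mem_Ici.2 le_rfl)
      (mem_Ici.2 hp.1.le) (mem_Ici.2 ht.1.le) hp.1.ne' ht.1.ne' hpt
    have hslope : (lqReal ν t - lqReal ν 0) / (t - 0) < -lqReal ν 0 := by
      rw [sub_zero, div_lt_iff₀ ht.1]
      linarith
    have hp_slope := hsecant.trans_lt hslope
    rw [sub_zero, div_lt_iff₀ hp.1] at hp_slope
    linarith

theorem continuousAt_lqReal (hq : 0 < q) : ContinuousAt (lqReal ν) q :=
  (((convexOn_lqReal hsupp).subset Ioi_subset_Ici_self (convex_Ioi 0)).continuousOn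
    isOpen_Ioi).continuousAt (Ioi_mem_nhds hq)

theorem upperSpectralDim_le_of_lqReal_lt (hq : 0 ≤ q) (h : lqReal ν q < q) :
    upperSpectralDim ν ≤ (q : EReal) := by
  obtain ⟨c, hc, hcq⟩ := exists_between h
  exact (hasGrowth_of_lqReal_lt hsupp hq hc).upperSpectralDim_le hsupp hq hcq

theorem upperSpectralDim_lt_of_lqReal_lt (hq : 0 < q) (h : lqReal ν q < q) :
    upperSpectralDim ν < (q : EReal) := by
  have hnear : ∀ᶠ p in 𝓝[<] q, 0 < p ∧ lqReal ν p < p :=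
    mem_nhdsWithin_of_mem_nhds
      ((lt_mem_nhds hq).and ((continuousAt_lqReal hsupp hq).eventually_lt continuousAt_id h))
  obtain ⟨p, ⟨hp, hlt⟩, hpq⟩ := (hnear.and self_mem_nhdsWithin).exists
  exact (upperSpectralDim_le_of_lqReal_lt hsupp hp.le hlt).trans_lt (EReal.coe_lt_coe_iff.2 hpq)

theorem upperSpectralDim_le :
    upperSpectralDim ν ≤ ((lqReal ν 0 / (1 + lqReal ν 0) : ℝ) : EReal) := by
  have hD : 0 ≤ lqReal ν 0 := lqReal_nonneg hsupp le_rfl zero_le_one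
  refine EReal.le_of_forall_lt_iff_le.1 fun q hq => ?_
  rw [EReal.coe_lt_coe_iff] at hq
  have hq0 : 0 < q := (by positivity : 0 ≤ lqReal ν 0 / (1 + lqReal ν 0)).trans_lt hq
  refine upperSpectralDim_le_of_lqReal_lt hsupp hq0.le ?_
  rcases le_total q 1 with hq1 | hq1
  · rw [div_lt_iff₀ (by positivity)] at hq
    linarith [lqReal_le_chord hsupp hq0.le hq1]
  · exact (lqReal_nonpos hsupp hq1).trans_lt hq0

theorem lqReal_zero_div_le_half : lqReal ν 0 / (1 + lqReal ν 0) ≤ 1 / 2 := by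
  have hD0 : 0 ≤ lqReal ν 0 := lqReal_nonneg hsupp le_rfl zero_le_one
  have hD1 : lqReal ν 0 ≤ 1 := (hasGrowth_zero_one ν).lqReal_le hsupp le_rfl
  rw [div_le_div_iff₀ (by positivity) two_pos]
  linarith

theorem lqReal_le_of_upperSpectralDim_lt (h : upperSpectralDim ν < (s : EReal)) (hsq : s < q) :
    lqReal ν q ≤ s := by
  have hs : 0 ≤ s := EReal.coe_nonneg.1 ((upperSpectralDim_nonneg hsupp).trans h.le)
  exact (hasGrowth_of_eigenvalueNum_le hsupp hs hsq
    (eventually_eigenvalueNum_le_rpow hsupp h)).lqReal_le hsupp (hs.trans hsq.le)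

variable (hUp : Tendsto (fun t => lqReal ν t / (1 - t)) (𝓝[<] 1) (𝓝 d))
include hUp

theorem mul_one_sub_le_lqReal (h0 : 0 ≤ t) (h1 : t < 1) : d * (1 - t) ≤ lqReal ν t := by
  rw [← le_div_iff₀ (sub_pos.2 h1)]
  refine le_of_tendsto hUp ?_
  filter_upwards [Ioo_mem_nhdsLT h1] with r hr
  exact lqReal_div_antitone hsupp h0 h1.ne hr.2.ne hr.1.le

theorem div_le_lowerSpectralDim_of_tendsto
    (hLow : Tendsto (fun t => lqReal ν t / (1 - t)) (𝓝[>] 1) (𝓝 d')) :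
    ((d' / (1 + d) : ℝ) : EReal) ≤ lowerSpectralDim ν := by
  have hd : 0 ≤ d := nonneg_of_tendsto_lqReal_div hsupp hUp
  rcases (nonneg_of_tendsto_lqReal_div hsupp hLow).eq_or_lt with rfl | hd'
  · simpa using lowerSpectralDim_nonneg hsupp
  have hcont : ContinuousAt (fun ε : ℝ => (((d' - ε) / (1 + (d + ε)) : ℝ) : EReal)) 0 :=
    continuous_coe_real_ereal.continuousAt.comp
      ((by fun_prop : ContinuousAt (fun ε => d' - ε) 0).div (by fun_prop) (by positivity))
  have hlim := hcont.tendsto.mono_left (nhdsWithin_le_nhds (s := Ioi 0))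
  rw [sub_zero, add_zero] at hlim
  refine le_of_tendsto hlim ?_
  filter_upwards [Ioo_mem_nhdsGT hd'] with ε hε
  obtain ⟨t, htUp, ht⟩ := ((hUp.eventually_lt_const (lt_add_of_pos_right d hε.1)).and
    (Ioo_mem_nhdsLT one_pos)).exists
  obtain ⟨t', htLow, ht'⟩ := ((hLow.eventually_const_lt (sub_lt_self d' hε.1)).and
    self_mem_nhdsWithin).exists
  rw [div_lt_iff₀ (sub_pos.2 ht.2)] at htUp
  rw [lt_div_iff_of_neg (sub_neg.2 ht')] at htLow
  obtain ⟨c, hc, hcUp⟩ := exists_between htUp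
  obtain ⟨c', hc', hcLow⟩ := exists_between htLow
  exact div_le_lowerSpectralDim hsupp ht.2 (hasGrowth_of_lqReal_lt hsupp ht.1.le hc) hcUp ht'
    (hasGrowth_of_lqReal_lt hsupp (one_pos.trans ht').le hc') hcLow
    (add_nonneg hd hε.1.le) (sub_nonneg.2 hε.2.le)

theorem div_le_upperSpectralDim : ((d / (1 + d) : ℝ) : EReal) ≤ upperSpectralDim ν := by
  have hd : 0 ≤ d := nonneg_of_tendsto_lqReal_div hsupp hUp
  refine EReal.le_of_forall_lt_iff_le.1 fun s hs => ?_
  rw [EReal.coe_le_coe_iff, div_le_iff₀ (by positivity)]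
  rcases le_or_gt 1 s with hs1 | hs1
  · nlinarith
  have hs0 : 0 ≤ s := EReal.coe_nonneg.1 ((upperSpectralDim_nonneg hsupp).trans hs.le)
  have hbound : d * (1 - s) ≤ s := by
    have hcont : Tendsto (fun q => d * (1 - q)) (𝓝[>] s) (𝓝 (d * (1 - s))) :=
      (by fun_prop : Continuous fun q => d * (1 - q)).continuousWithinAt
    refine le_of_tendsto hcont ?_
    filter_upwards [Ioo_mem_nhdsGT hs1] with q hq
    exact (mul_one_sub_le_lqReal hsupp hUp (hs0.trans hq.1.le) hq.2).trans
      (lqReal_le_of_upperSpectralDim_lt hsupp hs hq.1)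
  linarith

theorem upperSpectralDim_lt_of_lt (hlt : d < lqReal ν 0) :
    upperSpectralDim ν < ((lqReal ν 0 / (1 + lqReal ν 0) : ℝ) : EReal) := by
  have hD : 0 < lqReal ν 0 := (nonneg_of_tendsto_lqReal_div hsupp hUp).trans_lt hlt
  have hp0 : 0 < lqReal ν 0 / (1 + lqReal ν 0) := by positivity
  have hp1 : lqReal ν 0 / (1 + lqReal ν 0) < 1 := by
    rw [div_lt_one (by positivity)]
    linarith
  have hfix : lqReal ν 0 * (1 - lqReal ν 0 / (1 + lqReal ν 0)) =
      lqReal ν 0 / (1 + lqReal ν 0) := by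
    field_simp
    ring
  obtain ⟨t, htUp, ht⟩ := ((hUp.eventually_lt_const hlt).and (Ioo_mem_nhdsLT one_pos)).exists
  refine upperSpectralDim_lt_of_lqReal_lt hsupp hp0 ?_
  exact (lqReal_lt_chord hsupp ⟨hp0, hp1⟩ ht ((div_lt_iff₀ (sub_pos.2 ht.2)).1 htUp)).trans_eq hfix

theorem upperSpectralDim_eq_iff :
    upperSpectralDim ν = ((lqReal ν 0 / (1 + lqReal ν 0) : ℝ) : EReal) ↔ d = lqReal ν 0 := by
  have hle : d ≤ lqReal ν 0 := by simpa using mul_one_sub_le_lqReal hsupp hUp le_rfl one_pos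
  refine ⟨fun h => hle.eq_of_not_lt fun hlt => (upperSpectralDim_lt_of_lt hsupp hUp hlt).ne h, ?_⟩
  rintro rfl
  exact (upperSpectralDim_le hsupp).antisymm (div_le_upperSpectralDim hsupp hUp)

end OneSidedSlopes
end

end KreinFeller

/-- `dLow`, `dUp` are the negated right and left derivatives of the `L^q`-spectrum at `1`, `dStar`
is the upper Minkowski dimension of the support, and `sLow`, `sUp` are the spectral dimensions. -/
theorem corollary1p6 (ν : MeasureTheory.Measure ℝ) [MeasureTheory.IsFiniteMeasure ν]
    (hν : ν ≠ 0) (hsupp : ν (Set.Ioo (0 : ℝ) 1)ᶜ = 0) :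
    ∃ dLow dUp dStar sLow sUp : ℝ,
      Tendsto (fun t : ℝ => KreinFeller.lqSpectrum ν t / ((1 - t : ℝ) : EReal))
        (𝓝[>] (1 : ℝ)) (𝓝 (dLow : EReal)) ∧
      Tendsto (fun t : ℝ => KreinFeller.lqSpectrum ν t / ((1 - t : ℝ) : EReal))
        (𝓝[<] (1 : ℝ)) (𝓝 (dUp : EReal)) ∧
      KreinFeller.upperMinkowskiDim ν.support = (dStar : EReal) ∧
      KreinFeller.lowerSpectralDim ν = (sLow : EReal) ∧
      KreinFeller.upperSpectralDim ν = (sUp : EReal) ∧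
      dLow / (1 + dUp) ≤ sLow ∧
      sLow ≤ sUp ∧
      sUp ≤ dStar / (1 + dStar) ∧
      dStar / (1 + dStar) ≤ 1 / 2 ∧
      (sUp = dStar / (1 + dStar) ↔ dUp = dStar) := by
  open KreinFeller in
  have : NeZero ν := ⟨hν⟩
  obtain ⟨dUp, hUp⟩ := exists_tendsto_lqReal_div_left hsupp
  obtain ⟨dLow, hLow⟩ := exists_tendsto_lqReal_div_right hsupp
  have hlow := div_le_lowerSpectralDim_of_tendsto hsupp hUp hLow
  have hle : lowerSpectralDim ν ≤ upperSpectralDim ν := liminf_le_limsup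
  have hup := upperSpectralDim_le hsupp
  have hiff := upperSpectralDim_eq_iff hsupp hUp
  obtain ⟨sLow, hsLow⟩ :=
    exists_eq_coe_of_nonneg_of_le_coe (lowerSpectralDim_nonneg hsupp) (hle.trans hup)
  obtain ⟨sUp, hsUp⟩ := exists_eq_coe_of_nonneg_of_le_coe (upperSpectralDim_nonneg hsupp) hup
  simp only [hsLow, hsUp, EReal.coe_le_coe_iff, EReal.coe_eq_coe_iff] at hlow hle hup hiff
  exact ⟨dLow, dUp, lqReal ν 0, sLow, sUp, tendsto_lqSpectrum_div hsupp hLow,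
    tendsto_lqSpectrum_div hsupp hUp, upperMinkowskiDim_support hsupp, hsLow, hsUp, hlow, hle, hup,
    lqReal_zero_div_le_half hsupp, hiff⟩
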